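/- Let $\mathcal D$ be the product distribution on $\{0,1\}^d$ with $\Pr[\mathbf x_i=1]=p_i$, where $0\le p_i<1/2$. A query $\mathbf q$ is $\alpha$-correlated with $\mathbf x\sim\mathcal D$ if, independently for each $i$, $\mathbf q_i=\mathbf x_i$ with probability $\alpha$ and $\mathbf q_i=\mathbf z_i$ otherwise, where $\mathbf z\sim\mathcal D$ is a noise vector independent of the data. *Data structure.* Write $m=\sum_{i}p_i$ and $\hat p_i=p_i(1-\alpha)+\alpha$. A path is a sequence of distinct coordinates; it is complete if the product of its $p_i$ is at most $1/n$. In each of $\lceil\kappa\log^2 n\rceil$ independent repetitions, take for each of the $\lfloor\log_2 n\rfloor+1$ levels (longer paths are always complete) an independently chosen hash function from a pairwise independent family with values uniform on $[0,1]$. The filters $F(\mathbf x)$ of $\mathbf x$ are the complete paths found by the following recursion, started at the empty path: an incomplete path $v$ of length $j$ is extended by every $i\notin v$ with $\mathbf x_i=1$ for which the hash value of $v\circ i$ is less than $(1+\delta)/(\hat p_i m-j)$. An inverted index stores, for each repetition and each filter $f$, the data vectors $\mathbf y$ with $f\in F(\mathbf y)$. A query computes $F(\mathbf q)$ in every repetition,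 compares $\mathbf q$ with all vectors stored under the filters found, and returns the one with the largest Braun–Blanquet similarity $|\mathbf y\cap\mathbf q|/\max(|\mathbf y|,|\mathbf q|)$. Cost is counted in elementary steps: evaluating a hash function on a path, searching a path for a coordinate, testing completeness, or looking up a filter costs the length of the path plus one; reading a bit of $\mathbf q$ costs one; comparing two vectors costs $d+1$. Space is counted in words (one for each bit of a data vector and for each $p_i$, two for each hash function, and the length of the path plus two for each index entry). **Theorem.** For every $0<\alpha\le 1$, $\varepsilon>0$ and $c>0$ there are constants $C,\delta,\kappa,K>0$, depending only on $\alpha,\varepsilon,c$, such that the following holds for all $n\ge 2$, all $d$, all $p_1,\dots,p_d\in[0,1/2)$ with $\sum_i p_i\ge C\log n$, and every real $\rho$ with $$\sum_{i=1}^d\frac{p_i^{1+\rho}}{p_i(1-\alpha)+\alpha}=\sum_{i=1}^d p_i .$$ Let $S$ consist of $n$ vectors drawn independently from $\mathcal D$, let $\mathbf x$ be any fixed one of them (say the $j$-th), and let $\mathbf q$ be $\alpha$-correlated with $\mathbf x$. Then the data structure returns $\mathbf x$ on query $\mathbf q$ with probability at least $1-n^{-c}$; the expected cost of the query is at most $K\,d\,n^{\rho+\varepsilon}$;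 and the expected space of the data structure is at most $K\,(n^{1+\rho+\varepsilon}+dn)$. (Probabilities and expectations are over the data, the query and the hash functions.) -/

import Mathlib

open MeasureTheory ProbabilityTheory

namespace SkewSearch

noncomputable section

/-! ### The random model -/

/-- Law of a single bit which equals `true` with probability `p`. -/
def bitLaw (p : ℝ) : Measure Bool :=
  ENNReal.ofReal p • Measure.dirac true + ENNReal.ofReal (1 - p) • Measure.dirac false

/-- The product distribution on `{0,1}^d` with bit probabilities `p i`. -/
def vecLaw {d : ℕ} (p : Fin d → ℝ) : Measure (Fin d → Bool) :=
  Measure.pi fun i => bitLaw (p i)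

/-- `q i = x i` where the coin `c i` shows `true`, and `q i = z i` (noise) elsewhere. -/
def correlate {d : ℕ} (x z c : Fin d → Bool) : Fin d → Bool :=
  fun i => if c i then x i else z i

/-- A (real-valued) hash function on paths, i.e. on finite sequences of coordinates. -/
abbrev Hash (d : ℕ) : Type := List (Fin d) → ℝ

/-- A pairwise independent family of hash functions with values uniform on `[0,1]`, given as the
law of a random member. -/
structure IsPairwiseIndepHash {d : ℕ} (𝓗 : Measure (Hash d)) : Prop where
  isProbabilityMeasure : IsProbabilityMeasure 𝓗
  uniform : ∀ v : List (Fin d), 𝓗.map (fun h => h v) = volume.restrict (Set.Icc (0 : ℝ) 1)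
  indep : ∀ v w : List (Fin d), v ≠ w → IndepFun (fun h : Hash d => h v) (fun h => h w) 𝓗

/-- One outcome of all random choices: `n` data vectors, the noise vector, the coins that decide
which coordinates of the query are copied, and `T` hash functions for each of `L` repetitions. -/
structure Sample (n d L T : ℕ) where
  data : Fin n → Fin d → Bool
  noise : Fin d → Bool
  coin : Fin d → Bool
  hash : Fin L → Fin T → Hash d

/-- The query that is correlated with the `j`-th data vector. -/
def Sample.query {n d L T : ℕ} (ω : Sample n d L T) (j : Fin n) : Fin d → Bool :=
  correlate (ω.data j) ω.noise ω.coin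

/-- The random choices as a tuple. -/
abbrev RawSample (n d L T : ℕ) : Type :=
  (Fin n → Fin d → Bool) × (Fin d → Bool) × (Fin d → Bool) × (Fin L → Fin T → Hash d)

/-- The tuple, with its components named. -/
def RawSample.named {n d L T : ℕ} (t : RawSample n d L T) : Sample n d L T :=
  ⟨t.1, t.2.1, t.2.2.1, t.2.2.2⟩

/-- All choices are independent: data vectors and noise are drawn from the product distribution,
each coin shows `true` with probability `α`, and each hash function is drawn from `𝓗`. -/
def sampleLaw {d : ℕ} (n L T : ℕ) (p : Fin d → ℝ) (α : ℝ) (𝓗 : Measure (Hash d)) :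
    Measure (RawSample n d L T) :=
  (Measure.pi fun _ : Fin n => vecLaw p).prod
    ((vecLaw p).prod
      ((vecLaw fun _ : Fin d => α).prod
        (Measure.pi fun _ : Fin L => Measure.pi fun _ : Fin T => 𝓗)))

/-! ### Computations with a step count -/

/-- The result of a computation together with the number of elementary steps it took. -/
structure Timed (A : Type) where
  val : A
  steps : ℕ

/-- Perform `k` additional steps. -/
def Timed.tick {A : Type} (k : ℕ) (t : Timed A) : Timed A := ⟨t.val, t.steps + k⟩

/-- Run `f` on every element of a list, one after the other, and concatenate the results. -/
def Timed.collect {A B : Type} (l : List A) (f : A → Timed (List B)) : Timed (List B) :=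
  ⟨l.flatMap fun a => (f a).val, (l.map fun a => (f a).steps).sum⟩

/-! ### Choosing the filters of a vector -/

/-- The probability that a bit of the data vector is set, given that this bit is set in the
correlated query (and conversely). -/
def phat (p α : ℝ) : ℝ := p * (1 - α) + α

/-- The probability threshold for extending a path of `j` coordinates by the coordinate `i`. -/
def threshold {d : ℕ} (p : Fin d → ℝ) (α δ : ℝ) (j : ℕ) (i : Fin d) : ℝ :=
  (1 + δ) / (phat (p i) α * (∑ k, p k) - j)

/-- A path is complete as soon as a random vector contains it with probability at most `1 / n`. -/
def Complete {d : ℕ} (n : ℕ) (p : Fin d → ℝ) (v : List (Fin d)) : Prop :=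
  (v.map p).prod ≤ 1 / (n : ℝ)

open Classical in
/-- Recursive exploration of the paths of `x` that extend `v`; the list contains the hash functions
of the levels still to come.  A path is stored with its last coordinate first.  A complete path is
output as a filter.  Any other path `v` is extended by every coordinate `i` of `x` that does not
occur in `v` and for which the hash value of the extended path is below the threshold.

Steps: `|v| + 1` for the completeness test; for every coordinate, one for reading the bit,
`|v| + 1` for searching `v`, and `|v| + 1` for evaluating and comparing the hash value. -/
def explore {d : ℕ} (n : ℕ) (p : Fin d → ℝ) (α δ : ℝ) (x : Fin d → Bool) :
    List (Hash d) → List (Fin d) → Timed (List (List (Fin d)))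
  | [], v =>
      if Complete n p v then ⟨[v], v.length + 1⟩ else ⟨[], v.length + 1⟩
  | h :: hs, v =>
      if Complete n p v then ⟨[v], v.length + 1⟩
      else
        (Timed.collect (List.finRange d) fun i =>
          (if x i = true ∧ i ∉ v ∧ h (i :: v) < threshold p α δ v.length i then
            explore n p α δ x hs (i :: v)
          else ⟨[], 0⟩).tick (1 + 2 * (v.length + 1))).tick (v.length + 1)

/-- The filters of `x`, computed with the given hash functions (one for each level). -/
def filters {d T : ℕ} (n : ℕ) (p : Fin d → ℝ) (α δ : ℝ) (h : Fin T → Hash d) (x : Fin d → Bool) :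
    Timed (List (List (Fin d))) :=
  explore n p α δ x (List.ofFn h) []

/-! ### The data structure -/

/-- The data vectors, the hash functions of every repetition, and an inverted index: the entry
`(r, f, y)` says that, in repetition `r`, the filter `f` was chosen by the data vector `y`. -/
structure DataStructure (n d L T : ℕ) where
  vectors : Fin n → Fin d → Bool
  hash : Fin L → Fin T → Hash d
  index : List (Fin L × List (Fin d) × Fin n)

/-- Preprocessing. -/
def build {n d L T : ℕ} (p : Fin d → ℝ) (α δ : ℝ) (S : Fin n → Fin d → Bool)
    (h : Fin L → Fin T → Hash d) : DataStructure n d L T where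
  vectors := S
  hash := h
  index := (List.finRange L).flatMap fun r => (List.finRange n).flatMap fun y =>
    (filters n p α δ (h r) (S y)).val.map fun f => (r, f, y)

/-- Number of words: one for each bit of each data vector, one for each bit probability, two for
each (pairwise independent) hash function, and for each entry of the index one word for each
coordinate of the filter and two for the repetition and the pointer to the data vector. -/
def DataStructure.space {n d L T : ℕ} (D : DataStructure n d L T) : ℕ :=
  n * d + d + 2 * (L * T) + (D.index.map fun e => e.2.1.length + 2).sum

/-- The data vectors that chose filter `f` in repetition `r`. -/
def DataStructure.bucket {n d L T : ℕ} (D : DataStructure n d L T) (r : Fin L)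
    (f : List (Fin d)) : List (Fin n) :=
  (D.index.filter fun e => decide (e.1 = r ∧ e.2.1 = f)).map fun e => e.2.2

/-- Hamming weight. -/
def weight {d : ℕ} (x : Fin d → Bool) : ℕ := (Finset.univ.filter fun i => x i = true).card

/-- Braun-Blanquet similarity `|x ∩ q| / max(|x|, |q|)`. -/
def similarity {d : ℕ} (x q : Fin d → Bool) : ℚ :=
  (weight fun i => x i && q i : ℚ) / (max (weight x) (weight q) : ℕ)

/-- Query algorithm: in every repetition compute the filters of `q`, look up the bucket of each
filter and compare `q` with each vector found there; return (the position of) the most similar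
vector found.

Steps, besides the computation of the filters: `|f| + 1` for looking up the bucket of `f` and
`d + 1` for each comparison of `q` with a data vector. -/
def DataStructure.search {n d L T : ℕ} (p : Fin d → ℝ) (α δ : ℝ) (D : DataStructure n d L T)
    (q : Fin d → Bool) : Timed (Option (Fin n)) :=
  let found : Timed (List (Fin n)) := Timed.collect (List.finRange L) fun r =>
    let F := filters n p α δ (D.hash r) q
    (Timed.collect F.val fun f =>
      (Timed.collect (D.bucket r f) fun y => ⟨[y], d + 1⟩).tick (f.length + 1)).tick F.steps
  ⟨found.val.argmax fun y => similarity (D.vectors y) q, found.steps⟩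

/-- Number of repetitions, for a constant `κ`. -/
def reps (κ : ℝ) (n : ℕ) : ℕ := ⌈κ * Real.log n ^ 2⌉₊

/-- Number of levels: a path of more than `log₂ n` coordinates is complete if all `p i < 1/2`. -/
def levels (n : ℕ) : ℕ := Nat.log 2 n + 1

/-- The data structure for the random data of the outcome `t`. -/
def built {n d L T : ℕ} (p : Fin d → ℝ) (α δ : ℝ) (t : RawSample n d L T) :
    DataStructure n d L T :=
  build p α δ t.named.data t.named.hash

/-- The search with the query that is correlated with the `j`-th data vector. -/
def answer {n d L T : ℕ} (p : Fin d → ℝ) (α δ : ℝ) (j : Fin n) (t : RawSample n d L T) :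
    Timed (Option (Fin n)) :=
  (built p α δ t).search p α δ (t.named.query j)

end

end SkewSearch

/-!
# Set similarity search for skewed data by chosen paths

*Cost and space.*  The exploration of a vector is bounded by a tree sum (`treeSum`): each node costs
something, each filter costs something else.  Every hash function serves one level only, so the
expectation over the hash functions weights each extension by its threshold
(`lintegral_treeSum_le`).  Averaged over the vector, a path `v` has weight `∏ p` along `v`.  As long
as `v` is incomplete, `n * ∏ p > 1`, hence the node may be charged the factor `(n * ∏ p) ^ ρ ≥ 1`;
since `∑ p ^ (1 + ρ) / phat = ∑ p`, the total charge of a level is at most `(1 + δ) ^ 2` times that of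
the previous one (`lintegral_expTreeSum_le`).  With `O(log n)` levels this gives `n ^ (ρ + ε)`.  The
bucket of a complete path contains on average at most one vector that is unrelated to the query,
because a random vector contains the path with probability at most `1 / n` (`lintegral_steps_le`).

*Success.*  The common filters of the query and its data vector `x` are the paths inside
`A = x ∩ q`.  If `∑_{i ∈ A} 1 / phat` is close to its expectation `∑ p`, the thresholds can be lowered
so that every path in `A` has exactly one extension on average (`criticalThreshold_spec`).  In this
critical branching process the number of complete paths has mean `1`, and pairwise independence of
the hash functions bounds its second moment by the number of levels plus one
(`lintegral_pathCount_mul_le`), so a common filter exists with probability `Ω(1 / log n)`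
(`measure_pathCount_eq_zero_le`), and the `Θ(log² n)` independent repetitions amplify this to
`1 - n ^ (-c - 1)`.  The remaining events concern data and query only: by Chernoff bounds
(`vecLaw_sum_le`, `vecLaw_le_sum`) the weight of `A` is large enough and `x` is more similar to the
query than all other data vectors (`inputLaw_badInputs_le`, `similarity_lt`).

None of the quantities in question has to be measurable: upper integrals and outer measures are
bounded through measurable majorants.
-/

namespace SkewSearch

/-! ### Product distributions on bit vectors -/

section BitLaws

instance bitLaw.isFiniteMeasure (p : ℝ) : IsFiniteMeasure (bitLaw p) := by
  constructor
  simp [bitLaw]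

lemma isProbabilityMeasure_bitLaw {p : ℝ} (h0 : 0 ≤ p) (h1 : p ≤ 1) :
    IsProbabilityMeasure (bitLaw p) := by
  constructor
  simp only [bitLaw, Measure.add_apply, Measure.smul_apply, measure_univ, smul_eq_mul, mul_one]
  rw [← ENNReal.ofReal_add h0 (by linarith)]
  simp

instance vecLaw.isFiniteMeasure {d : ℕ} (p : Fin d → ℝ) : IsFiniteMeasure (vecLaw p) := by
  unfold vecLaw; infer_instance

lemma isProbabilityMeasure_vecLaw {d : ℕ} {p : Fin d → ℝ} (hp : ∀ i, 0 ≤ p i ∧ p i ≤ 1) :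
    IsProbabilityMeasure (vecLaw p) := by
  have := fun i => isProbabilityMeasure_bitLaw (hp i).1 (hp i).2
  unfold vecLaw; infer_instance

lemma integral_bitLaw {p : ℝ} (h0 : 0 ≤ p) (h1 : p ≤ 1) (f : Bool → ℝ) :
    ∫ b, f b ∂bitLaw p = p * f true + (1 - p) * f false := by
  unfold bitLaw
  have i1 : Integrable f (ENNReal.ofReal p • Measure.dirac true) :=
    (integrable_dirac (by simp)).smul_measure ENNReal.ofReal_ne_top
  have i2 : Integrable f (ENNReal.ofReal (1 - p) • Measure.dirac false) :=
    (integrable_dirac (by simp)).smul_measure ENNReal.ofReal_ne_top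
  rw [integral_add_measure i1 i2]
  simp [integral_smul_measure, ENNReal.toReal_ofReal h0,
    ENNReal.toReal_ofReal (show 0 ≤ 1 - p by linarith)]

lemma integral_vecLaw_prod {d : ℕ} {p : Fin d → ℝ} (hp : ∀ i, 0 ≤ p i ∧ p i ≤ 1)
    (f : Fin d → Bool → ℝ) :
    ∫ y, ∏ i, f i (y i) ∂vecLaw p = ∏ i, (p i * f i true + (1 - p i) * f i false) := by
  unfold vecLaw
  rw [integral_fintype_prod_eq_prod]
  exact Finset.prod_congr rfl fun i _ => integral_bitLaw (hp i).1 (hp i).2 _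

/-- A random vector contains all coordinates of a duplicate-free path `v` with probability
equal to the product of the bit probabilities along `v`. -/
lemma vecLaw_forall_mem {d : ℕ} {p : Fin d → ℝ} (hp : ∀ i, 0 ≤ p i ∧ p i ≤ 1)
    {v : List (Fin d)} (hv : v.Nodup) :
    vecLaw p {y | ∀ i ∈ v, y i = true} = ENNReal.ofReal (v.map p).prod := by
  have hset : {y : Fin d → Bool | ∀ i ∈ v, y i = true}
      = Set.univ.pi fun i => if i ∈ v then {true} else Set.univ := by
    ext y
    simp only [Set.mem_ofPred_eq, Set.mem_pi, Set.mem_univ, true_implies]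
    refine forall_congr' fun i => ?_
    by_cases h : i ∈ v <;> simp [h]
  have := fun i => isProbabilityMeasure_bitLaw (hp i).1 (hp i).2
  rw [hset, vecLaw, Measure.pi_pi]
  have h1 : ∀ i, bitLaw (p i) (if i ∈ v then {true} else Set.univ)
      = if i ∈ v.toFinset then ENNReal.ofReal (p i) else 1 := by
    intro i
    by_cases h : i ∈ v
    · simp [h, bitLaw]
    · rw [if_neg h, if_neg (by simpa using h), measure_univ]
  simp_rw [h1]
  rw [Finset.prod_ite_mem, Finset.univ_inter, ← ENNReal.ofReal_prod_of_nonneg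
    (fun i _ => (hp i).1), List.prod_toFinset _ hv]

/-- Combining two independent product measures coordinate by coordinate gives a product
measure. -/
lemma map_pi_prod_pi {ι A B D : Type*} [Fintype ι] [MeasurableSpace A] [MeasurableSpace B]
    [MeasurableSpace D] (μ : ι → Measure A) (ν : ι → Measure B) [∀ i, IsFiniteMeasure (μ i)]
    [∀ i, IsFiniteMeasure (ν i)] {f : A → B → D} (hf : Measurable fun t : A × B => f t.1 t.2) :
    ((Measure.pi μ).prod (Measure.pi ν)).map (fun t i => f (t.1 i) (t.2 i))
      = Measure.pi fun i => ((μ i).prod (ν i)).map fun t => f t.1 t.2 := by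
  rw [← (measurePreserving_arrowProdEquivProdArrow A B ι μ ν).map_eq,
    Measure.map_map (by fun_prop) (MeasurableEquiv.measurable _),
    ← Measure.pi_map_pi (fun i => hf.aemeasurable)]
  rfl

lemma map_bitLaw_prod (a b : ℝ) (g : Bool → Bool → Bool) :
    ((bitLaw a).prod (bitLaw b)).map (fun t => g t.1 t.2)
      = (ENNReal.ofReal a * ENNReal.ofReal b) • Measure.dirac (g true true)
      + (ENNReal.ofReal a * ENNReal.ofReal (1 - b)) • Measure.dirac (g true false)
      + (ENNReal.ofReal (1 - a) * ENNReal.ofReal b) • Measure.dirac (g false true)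
      + (ENNReal.ofReal (1 - a) * ENNReal.ofReal (1 - b)) • Measure.dirac (g false false) := by
  have hm : Measurable fun t : Bool × Bool => g t.1 t.2 := measurable_of_finite _
  ext s hs
  rw [Measure.map_apply hm hs, Measure.prod_apply (hm hs)]
  simp only [bitLaw, lintegral_add_measure, lintegral_smul_measure, lintegral_dirac,
    Measure.add_apply, Measure.smul_apply, smul_eq_mul]
  simp only [Measure.dirac_apply]
  -- both sides now consist of the same four indicator values
  change _ * (_ * s.indicator 1 (g true true) + _ * s.indicator 1 (g true false))
    + _ * (_ * s.indicator 1 (g false true) + _ * s.indicator 1 (g false false)) = _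
  ring

lemma map_bitLaw_and {a b : ℝ} (ha : 0 ≤ a ∧ a ≤ 1) (hb : 0 ≤ b ∧ b ≤ 1) :
    ((bitLaw a).prod (bitLaw b)).map (fun t => t.1 && t.2) = bitLaw (a * b) := by
  rw [map_bitLaw_prod a b (fun s t => s && t)]
  simp only [Bool.and_true, Bool.and_false, bitLaw]
  rw [add_assoc, add_assoc, ← add_smul, ← add_smul, ← ENNReal.ofReal_mul ha.1,
    ← ENNReal.ofReal_mul ha.1, ← ENNReal.ofReal_mul (by linarith),
    ← ENNReal.ofReal_mul (by linarith),
    ← ENNReal.ofReal_add (by nlinarith) (by nlinarith),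
    ← ENNReal.ofReal_add (by nlinarith) (by nlinarith)]
  congr 3
  ring

lemma map_bitLaw_or {a b : ℝ} (ha : 0 ≤ a ∧ a ≤ 1) (hb : 0 ≤ b ∧ b ≤ 1) :
    ((bitLaw a).prod (bitLaw b)).map (fun t => t.1 || t.2) = bitLaw (a + b - a * b) := by
  rw [map_bitLaw_prod a b (fun s t => s || t)]
  simp only [Bool.or_true, Bool.or_false, bitLaw]
  rw [← add_smul, ← add_smul, ← ENNReal.ofReal_mul ha.1,
    ← ENNReal.ofReal_mul ha.1, ← ENNReal.ofReal_mul (by linarith),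
    ← ENNReal.ofReal_mul (by linarith),
    ← ENNReal.ofReal_add (by nlinarith) (by nlinarith),
    ← ENNReal.ofReal_add (by nlinarith) (by nlinarith)]
  congr 3 <;> ring

lemma map_vecLaw_and {d : ℕ} {a b : Fin d → ℝ} (ha : ∀ i, 0 ≤ a i ∧ a i ≤ 1)
    (hb : ∀ i, 0 ≤ b i ∧ b i ≤ 1) :
    ((vecLaw a).prod (vecLaw b)).map (fun t i => t.1 i && t.2 i)
      = vecLaw fun i => a i * b i := by
  unfold vecLaw
  rw [map_pi_prod_pi _ _ (f := fun s t : Bool => s && t) (measurable_of_finite _)]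
  simp_rw [map_bitLaw_and (ha _) (hb _)]

lemma map_vecLaw_or {d : ℕ} {a b : Fin d → ℝ} (ha : ∀ i, 0 ≤ a i ∧ a i ≤ 1)
    (hb : ∀ i, 0 ≤ b i ∧ b i ≤ 1) :
    ((vecLaw a).prod (vecLaw b)).map (fun t i => t.1 i || t.2 i)
      = vecLaw fun i => a i + b i - a i * b i := by
  unfold vecLaw
  rw [map_pi_prod_pi _ _ (f := fun s t : Bool => s || t) (measurable_of_finite _)]
  simp_rw [map_bitLaw_or (ha _) (hb _)]

/-- A single bit of an `α`-correlated query has the distribution of the data bit. -/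
lemma map_bitLaw_correlate {p α : ℝ} (hp : 0 ≤ p ∧ p ≤ 1) (hα : 0 ≤ α ∧ α ≤ 1) :
    ((bitLaw p).prod ((bitLaw p).prod (bitLaw α))).map
      (fun t => if t.2.2 then t.1 else t.2.1) = bitLaw p := by
  have := isProbabilityMeasure_bitLaw hα.1 hα.2
  have := isProbabilityMeasure_bitLaw hp.1 hp.2
  have hm : Measurable fun t : Bool × Bool × Bool => if t.2.2 then t.1 else t.2.1 :=
    measurable_of_finite _
  ext s hs
  rw [Measure.map_apply hm hs, ← lintegral_indicator_one (hm hs),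
    lintegral_prod _ (measurable_of_finite _).aemeasurable]
  simp_rw [lintegral_prod _ (measurable_of_finite _).aemeasurable]
  simp only [bitLaw, lintegral_add_measure, lintegral_smul_measure, lintegral_dirac,
    Measure.add_apply, Measure.smul_apply, smul_eq_mul]
  rw [Measure.dirac_apply' _ hs, Measure.dirac_apply' _ hs]
  have e1 : ENNReal.ofReal p + ENNReal.ofReal (1 - p) = 1 := by
    rw [← ENNReal.ofReal_add hp.1 (by linarith [hp.2])]; simp
  have e2 : ENNReal.ofReal α + ENNReal.ofReal (1 - α) = 1 := by
    rw [← ENNReal.ofReal_add hα.1 (by linarith [hα.2])]; simp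
  have key : ∀ a b u w A B : ENNReal, a + b = 1 → u + w = 1 →
      a * (a * (u * A + w * A) + b * (u * A + w * B))
        + b * (a * (u * B + w * A) + b * (u * B + w * B)) = a * A + b * B := by
    intro a b u w A B h1 h2
    calc _ = (a + b) * (u + w) * (a * A + b * B) := by ring
      _ = _ := by rw [h1, h2]; ring
  exact key _ _ _ _ _ _ e1 e2

/-- The query that is correlated with a random data vector is itself distributed like a data
vector. -/
lemma map_vecLaw_correlate {d : ℕ} {p : Fin d → ℝ} {α : ℝ} (hp : ∀ i, 0 ≤ p i ∧ p i ≤ 1)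
    (hα : 0 ≤ α ∧ α ≤ 1) :
    ((vecLaw p).prod ((vecLaw p).prod (vecLaw fun _ : Fin d => α))).map
      (fun t => correlate t.1 t.2.1 t.2.2) = vecLaw p := by
  have h2 : ((vecLaw p).prod (vecLaw fun _ : Fin d => α)).map
      (fun t i => (t.1 i, t.2 i)) = Measure.pi fun i => (bitLaw (p i)).prod (bitLaw α) := by
    unfold vecLaw
    rw [map_pi_prod_pi _ _ (f := fun s t : Bool => (s, t)) (measurable_of_finite _)]
    simp
  have h3 := map_pi_prod_pi (fun i => bitLaw (p i)) (fun i => (bitLaw (p i)).prod (bitLaw α))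
    (f := fun (x : Bool) (zc : Bool × Bool) => if zc.2 then x else zc.1) (measurable_of_finite _)
  simp_rw [map_bitLaw_correlate (hp _) hα] at h3
  rw [← h2] at h3
  change _ = vecLaw p at h3
  refine Eq.trans ?_ h3
  have h4 : (Measure.pi fun i => bitLaw (p i)) = (vecLaw p).map id := by
    rw [Measure.map_id]; rfl
  rw [h4, Measure.map_prod_map _ _ measurable_id (measurable_of_finite _),
    Measure.map_map (measurable_of_finite _) (measurable_of_finite _)]
  rfl

end BitLaws

/-! ### Chernoff bounds -/

section Chernoff

/-- The lower Chernoff bound for weighted sums of independent bits. -/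
lemma vecLaw_sum_le {d : ℕ} {r w : Fin d → ℝ} (hr : ∀ i, 0 ≤ r i ∧ r i ≤ 1)
    (hw : ∀ i, 0 ≤ w i ∧ w i ≤ 1) {M η : ℝ} (hM : ∑ i, r i * w i ≤ M) (hη : 0 ≤ η) :
    vecLaw r {y | ∑ i, (if y i = true then w i else 0) ≤ ∑ i, r i * w i - η * M}
      ≤ ENNReal.ofReal (Real.exp (-(η ^ 2 * M / 2))) := by
  have := isProbabilityMeasure_vecLaw hr
  have hmgf : mgf (fun y : Fin d → Bool => -∑ i, (if y i = true then w i else 0)) (vecLaw r) η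
      ≤ Real.exp (-((η - η ^ 2 / 2) * ∑ i, r i * w i)) := by
    have : mgf (fun y : Fin d → Bool => -∑ i, (if y i = true then w i else 0)) (vecLaw r) η
        = ∏ i, (r i * Real.exp (-(η * w i)) + (1 - r i) * 1) := by
      unfold mgf
      have e := integral_vecLaw_prod hr
        (fun i b => if b = true then Real.exp (-(η * w i)) else 1)
      simp only [if_true, Bool.false_eq_true, if_false] at e
      rw [← e]
      congr 1
      ext y
      beta_reduce
      rw [mul_neg, Finset.mul_sum, ← Finset.sum_neg_distrib, Real.exp_sum]
      refine Finset.prod_congr rfl fun i _ => ?_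
      split_ifs <;> simp
    rw [this, Finset.mul_sum, ← Finset.sum_neg_distrib, Real.exp_sum]
    refine Finset.prod_le_prod (fun i _ => ?_) fun i _ => ?_
    · have := (hr i).1; have := (hr i).2; have := Real.exp_pos (-(η * w i)); nlinarith
    · -- `exp (-u) ≤ 1 - u + u ^ 2 / 2` for `u ≥ 0`, applied to `u = η * w i`
      have hu : 0 ≤ η * w i := mul_nonneg hη (hw i).1
      have h1 : Real.exp (-(η * w i)) ≤ 1 - η * w i + (η * w i) ^ 2 / 2 := by
        have h := Real.quadratic_le_exp_of_nonneg hu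
        have h3 : Real.exp (-(η * w i)) * Real.exp (η * w i) = 1 := by
          rw [← Real.exp_add]; simp
        have h2 : (1 - η * w i + (η * w i) ^ 2 / 2) * (1 + η * w i + (η * w i) ^ 2 / 2) ≥ 1 := by
          nlinarith [sq_nonneg ((η * w i) ^ 2)]
        have h4 : 0 < 1 - η * w i + (η * w i) ^ 2 / 2 := by nlinarith [sq_nonneg (η * w i - 1)]
        have h5 : 0 < Real.exp (η * w i) := Real.exp_pos _
        have h6 : Real.exp (-(η * w i)) * Real.exp (η * w i)
            ≤ (1 - η * w i + (η * w i) ^ 2 / 2) * Real.exp (η * w i) := by nlinarith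
        exact le_of_mul_le_mul_right h6 h5
      have h7 : (η * w i) ^ 2 ≤ η ^ 2 * w i := by
        have := (hw i).1; have := (hw i).2
        nlinarith [mul_nonneg (sq_nonneg η) (mul_nonneg (hw i).1 (sub_nonneg.2 (hw i).2))]
      have h8 := Real.add_one_le_exp (-((η - η ^ 2 / 2) * (r i * w i)))
      have h9 := mul_le_mul_of_nonneg_left h1 (hr i).1
      have h10 := mul_le_mul_of_nonneg_left h7 (hr i).1
      nlinarith
  have h := measure_ge_le_exp_mul_mgf (μ := vecLaw r)
    (X := fun y : Fin d → Bool => -∑ i, (if y i = true then w i else 0))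
    (-(∑ i, r i * w i - η * M)) hη Integrable.of_finite
  have hset : {y : Fin d → Bool | ∑ i, (if y i = true then w i else 0) ≤ ∑ i, r i * w i - η * M}
      = {y | -(∑ i, r i * w i - η * M) ≤ -∑ i, (if y i = true then w i else 0)} := by
    ext y
    simp only [Set.mem_ofPred_eq, neg_le_neg_iff]
  rw [hset, ← ofReal_measureReal]
  refine ENNReal.ofReal_le_ofReal (h.trans ?_)
  refine (mul_le_mul_of_nonneg_left hmgf (Real.exp_pos _).le).trans ?_
  rw [← Real.exp_add]
  refine Real.exp_le_exp.2 ?_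
  nlinarith [mul_le_mul_of_nonneg_left hM (sq_nonneg η)]

/-- The upper Chernoff bound for sums of independent bits. -/
lemma vecLaw_le_sum {d : ℕ} {r : Fin d → ℝ} (hr : ∀ i, 0 ≤ r i ∧ r i ≤ 1)
    {M η : ℝ} (hM : ∑ i, r i ≤ M) (hη : 0 ≤ η) (hη2 : η ≤ 2) :
    vecLaw r {y | ∑ i, r i + η * M ≤ ∑ i, (if y i = true then (1 : ℝ) else 0)}
      ≤ ENNReal.ofReal (Real.exp (-(η ^ 2 * M / 4))) := by
  have := isProbabilityMeasure_vecLaw hr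
  have hmgf : mgf (fun y : Fin d → Bool => ∑ i, (if y i = true then (1 : ℝ) else 0))
      (vecLaw r) (η / 2) ≤ Real.exp ((η / 2 + (η / 2) ^ 2) * ∑ i, r i) := by
    have : mgf (fun y : Fin d → Bool => ∑ i, (if y i = true then (1 : ℝ) else 0)) (vecLaw r)
        (η / 2) = ∏ i, (r i * Real.exp (η / 2) + (1 - r i) * 1) := by
      unfold mgf
      have e := integral_vecLaw_prod hr (fun i b => if b = true then Real.exp (η / 2) else 1)
      simp only [if_true, Bool.false_eq_true, if_false] at e
      rw [← e]
      congr 1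
      ext y
      beta_reduce
      rw [Finset.mul_sum, Real.exp_sum]
      refine Finset.prod_congr rfl fun i _ => ?_
      split_ifs <;> simp
    rw [this, Finset.mul_sum, Real.exp_sum]
    refine Finset.prod_le_prod (fun i _ => ?_) fun i _ => ?_
    · have := (hr i).1; have := (hr i).2; have := Real.exp_pos (η / 2); nlinarith
    · have h1 : Real.exp (η / 2) ≤ 1 + η / 2 + (η / 2) ^ 2 := by
        have := Real.abs_exp_sub_one_sub_id_le (x := η / 2) (by
          rw [abs_of_nonneg (by linarith)]; linarith)
        have := (abs_le.1 this).2
        linarith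
      have h8 := Real.add_one_le_exp ((η / 2 + (η / 2) ^ 2) * r i)
      have h9 := mul_le_mul_of_nonneg_left h1 (hr i).1
      nlinarith
  have h := measure_ge_le_exp_mul_mgf (μ := vecLaw r)
    (X := fun y : Fin d → Bool => ∑ i, (if y i = true then (1 : ℝ) else 0))
    (∑ i, r i + η * M) (show 0 ≤ η / 2 by linarith) Integrable.of_finite
  rw [← ofReal_measureReal]
  refine ENNReal.ofReal_le_ofReal (h.trans ?_)
  refine (mul_le_mul_of_nonneg_left hmgf (Real.exp_pos _).le).trans ?_
  rw [← Real.exp_add]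
  refine Real.exp_le_exp.2 ?_
  nlinarith [mul_le_mul_of_nonneg_left hM (sq_nonneg η)]

end Chernoff

/-! ### Paths found by the exploration -/

section Explore

variable {d : ℕ} {n : ℕ} {p : Fin d → ℝ} {α δ : ℝ}

/-- The vector `x` contains every coordinate of the path `v`. -/
def Contains {d : ℕ} (x : Fin d → Bool) (v : List (Fin d)) : Prop := ∀ i ∈ v, x i = true

lemma suffix_of_mem_explore {x : Fin d → Bool} {hs : List (Hash d)} {v f : List (Fin d)}
    (hf : f ∈ (explore n p α δ x hs v).val) : v <:+ f := by
  induction hs generalizing v with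
  | nil =>
    simp only [explore] at hf
    split_ifs at hf <;> simp_all
  | cons h hs ih =>
    simp only [explore] at hf
    split_ifs at hf with hc
    · simp_all
    · simp only [Timed.tick, Timed.collect, List.mem_flatMap] at hf
      obtain ⟨i, -, hi⟩ := hf
      split_ifs at hi with h1
      · exact (List.suffix_cons i v).trans (ih hi)
      · simp at hi

lemma contains_of_mem_explore {x : Fin d → Bool} {hs : List (Hash d)} {v f : List (Fin d)}
    (hv : Contains x v) (hf : f ∈ (explore n p α δ x hs v).val) : Contains x f := by
  induction hs generalizing v with
  | nil =>
    simp only [explore] at hf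
    split_ifs at hf <;> simp_all
  | cons h hs ih =>
    simp only [explore] at hf
    split_ifs at hf with hc
    · simp_all
    · simp only [Timed.tick, Timed.collect, List.mem_flatMap] at hf
      obtain ⟨i, -, hi⟩ := hf
      split_ifs at hi with h1
      · refine ih (fun k hk => ?_) hi
        rcases List.mem_cons.1 hk with rfl | hk
        · exact h1.1
        · exact hv k hk
      · simp at hi

lemma nodup_explore (x : Fin d → Bool) (hs : List (Hash d)) (v : List (Fin d)) :
    (explore n p α δ x hs v).val.Nodup := by
  induction hs generalizing v with
  | nil =>
    simp only [explore]
    split_ifs <;> simp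
  | cons h hs ih =>
    simp only [explore]
    split_ifs with hc
    · simp
    · simp only [Timed.tick, Timed.collect]
      rw [List.nodup_flatMap]
      refine ⟨fun i _ => ?_, ?_⟩
      · split_ifs
        · exact ih _
        · simp
      · refine (List.nodup_finRange d).imp ?_
        intro i k hik f h1 h2
        beta_reduce at h1 h2
        split_ifs at h1 h2
        · have e := List.suffix_of_suffix_length_le (suffix_of_mem_explore h1)
            (suffix_of_mem_explore h2) (by simp)
          have := e.eq_of_length (by simp)
          simp_all
        all_goals simp at h1 h2

open Classical in
/-- The exploration finds a filter only once, and only if the vector contains it. -/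
lemma count_filters_le {T : ℕ} (h : Fin T → Hash d) (x : Fin d → Bool) (f : List (Fin d)) :
    (filters n p α δ h x).val.count f ≤ if Contains x f then 1 else 0 := by
  split_ifs with hf
  · exact List.nodup_iff_count_le_one.1 (nodup_explore x _ _) f
  · rw [Nat.le_zero, List.count_eq_zero]
    exact fun hm => hf (contains_of_mem_explore (by simp [Contains]) hm)

open Classical in
/-- The sum over the nodes of the exploration tree of `x` below `v`, in which a complete path `w`
contributes `b w` and any other path contributes `a`. -/
noncomputable def treeSum {d : ℕ} (n : ℕ) (p : Fin d → ℝ) (α δ : ℝ) (a : ENNReal)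
    (b : List (Fin d) → ENNReal) (x : Fin d → Bool) :
    List (Hash d) → List (Fin d) → ENNReal
  | [], v => if Complete n p v then b v else a
  | h :: hs, v =>
      if Complete n p v then b v
      else a + ∑ i, if x i = true ∧ i ∉ v ∧ h (i :: v) < threshold p α δ v.length i then
        treeSum n p α δ a b x hs (i :: v) else 0

lemma sum_flatMap {A M : Type*} [AddMonoid M] (l : List A) (f : A → List M) :
    (l.flatMap f).sum = (l.map fun a => (f a).sum).sum := by
  induction l with
  | nil => simp
  | cons a l ih => simp [ih]

/-- A tree sum bounds the number of steps of the exploration (counted with weight `s`) together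
with any sum over the filters found. -/
lemma explore_le_treeSum {T : ℕ} {s a : ENNReal} {b g : List (Fin d) → ENNReal}
    (ha : s * ((T + 1 + d * (1 + 2 * (T + 1)) : ℕ) : ENNReal) ≤ a)
    (hb : ∀ w : List (Fin d), w.length ≤ T → s * ((T + 1 : ℕ) : ENNReal) + g w ≤ b w)
    (x : Fin d → Bool) (hs : List (Hash d)) (v : List (Fin d)) (hv : v.length + hs.length ≤ T) :
    s * (explore n p α δ x hs v).steps + ((explore n p α δ x hs v).val.map g).sum
      ≤ treeSum n p α δ a b x hs v := by
  have hleaf : ∀ w : List (Fin d), w.length ≤ T →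
      s * ((w.length + 1 : ℕ) : ENNReal) + g w ≤ b w := by
    intro w hw
    refine le_trans ?_ (hb w hw)
    gcongr
  induction hs generalizing v with
  | nil =>
    simp only [explore, treeSum]
    simp only [List.length_nil, add_zero] at hv
    split_ifs
    · simpa using hleaf v hv
    · simp only [List.map_nil, List.sum_nil, add_zero]
      refine le_trans ?_ ha
      refine mul_le_mul' le_rfl (Nat.cast_le.2 ?_)
      exact le_add_right (by omega)
  | cons h hs ih =>
    simp only [List.length_cons] at hv
    simp only [explore, treeSum]
    split_ifs
    · simpa using hleaf v (by omega)
    · simp only [Timed.tick, Timed.collect]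
      rw [List.map_flatMap, sum_flatMap, ← Fin.sum_univ_def, ← Fin.sum_univ_def]
      rw [Finset.sum_add_distrib]
      have h1 : s * ((((∑ _i : Fin d, (1 + 2 * (v.length + 1))) + (v.length + 1) : ℕ)) : ENNReal)
          ≤ a := by
        refine le_trans ?_ ha
        refine mul_le_mul' le_rfl (Nat.cast_le.2 ?_)
        simp only [Finset.sum_const, Finset.card_univ, Fintype.card_fin, smul_eq_mul]
        have : d * (1 + 2 * (v.length + 1)) ≤ d * (1 + 2 * (T + 1)) := by
          apply Nat.mul_le_mul_left; omega
        omega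
      have h2 : s * ((∑ i, (if x i = true ∧ i ∉ v ∧ h (i :: v) < threshold p α δ v.length i then
            explore n p α δ x hs (i :: v) else ⟨[], 0⟩ : Timed (List (List (Fin d)))).steps : ℕ)
              : ENNReal)
          + ∑ i, (List.map g (if x i = true ∧ i ∉ v ∧ h (i :: v) < threshold p α δ v.length i then
            explore n p α δ x hs (i :: v) else ⟨[], 0⟩ : Timed (List (List (Fin d)))).val).sum
          ≤ ∑ i, if x i = true ∧ i ∉ v ∧ h (i :: v) < threshold p α δ v.length i then
            treeSum n p α δ a b x hs (i :: v) else 0 := by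
        rw [Nat.cast_sum, Finset.mul_sum, ← Finset.sum_add_distrib]
        refine Finset.sum_le_sum fun i _ => ?_
        split_ifs
        · refine ih (i :: v) ?_
          simp only [List.length_cons]
          omega
        · simp
      refine le_trans (le_of_eq ?_) (add_le_add h1 h2)
      push_cast
      ring

end Explore

/-! ### The inverted index -/

section Index

variable {n d L T : ℕ} {p : Fin d → ℝ} {α δ : ℝ}

lemma mem_bucket_build {S : Fin n → Fin d → Bool} {h : Fin L → Fin T → Hash d} {r : Fin L}
    {f : List (Fin d)} {y : Fin n} :
    y ∈ (build p α δ S h).bucket r f ↔ f ∈ (filters n p α δ (h r) (S y)).val := by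
  simp only [DataStructure.bucket, build, List.mem_map, List.mem_filter, List.mem_flatMap,
    List.mem_finRange, true_and, decide_eq_true_eq]
  constructor
  · rintro ⟨e, ⟨⟨r', y', f', hf', rfl⟩, h1, h2⟩, rfl⟩
    simp only at h1 h2
    subst h1 h2
    exact hf'
  · intro hf
    exact ⟨(r, f, y), ⟨⟨r, y, f, hf, rfl⟩, rfl, rfl⟩, rfl⟩

lemma length_bucket_build (S : Fin n → Fin d → Bool) (h : Fin L → Fin T → Hash d) (r : Fin L)
    (f : List (Fin d)) :
    ((build p α δ S h).bucket r f).length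
      = ∑ y, (filters n p α δ (h r) (S y)).val.count f := by
  simp only [DataStructure.bucket, build, List.length_map]
  rw [← List.countP_eq_length_filter, List.countP_flatMap, ← Fin.sum_univ_def,
    Finset.sum_eq_single r]
  · simp only [Function.comp_apply, List.countP_flatMap]
    rw [← Fin.sum_univ_def]
    refine Finset.sum_congr rfl fun y _ => ?_
    rw [List.count, Function.comp_apply, List.countP_map]
    refine List.countP_congr fun g _ => ?_
    simp
  · intro r' _ hr'
    simp only [Function.comp_apply, List.countP_flatMap]
    rw [← Fin.sum_univ_def]
    refine Finset.sum_eq_zero fun y _ => ?_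
    rw [Function.comp_apply, List.countP_map, List.countP_eq_zero]
    simp [hr']
  · simp

open Classical in
/-- At most one entry for the `j`-th vector and for every other vector that contains `f`. -/
lemma length_bucket_build_le (S : Fin n → Fin d → Bool) (h : Fin L → Fin T → Hash d) (r : Fin L)
    (f : List (Fin d)) (j : Fin n) :
    ((build p α δ S h).bucket r f).length
      ≤ 1 + ∑ y ∈ Finset.univ.erase j, if Contains (S y) f then 1 else 0 := by
  rw [length_bucket_build, ← Finset.add_sum_erase _ _ (Finset.mem_univ j)]
  gcongr with y hy
  · refine (count_filters_le (h r) (S j) f).trans ?_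
    split_ifs <;> simp
  · exact count_filters_le (h r) (S y) f

open Classical in
/-- The cost of a query is bounded by tree sums in which every node carries the cost `a` of its
expansion and every filter the cost of its lookup and of the comparisons in its bucket. -/
lemma steps_search_le (S : Fin n → Fin d → Bool) (h : Fin L → Fin T → Hash d) (q : Fin d → Bool)
    (j : Fin n) {a : ENNReal} {b : List (Fin d) → ENNReal}
    (ha : ((T + 1 + d * (1 + 2 * (T + 1)) : ℕ) : ENNReal) ≤ a)
    (hb : ∀ f : List (Fin d), ((2 * (T + 1) + (d + 1)
      * (1 + ∑ y ∈ Finset.univ.erase j, if Contains (S y) f then 1 else 0) : ℕ) : ENNReal) ≤ b f) :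
    (((build p α δ S h).search p α δ q).steps : ENNReal)
      ≤ ∑ r, treeSum n p α δ a b q (List.ofFn (h r)) [] := by
  simp only [DataStructure.search, Timed.collect, Timed.tick]
  rw [← Fin.sum_univ_def, Nat.cast_sum]
  refine Finset.sum_le_sum fun r _ => ?_
  refine le_trans (le_of_eq ?_) (explore_le_treeSum (T := T) (s := 1) (a := a) (b := b)
    (g := fun f => ((((build p α δ S h).bucket r f).length * (d + 1) + (f.length + 1) : ℕ)
      : ENNReal)) (by simpa using ha) ?_ q (List.ofFn (h r)) [] (by simp))
  · rw [one_mul, Nat.cast_add, add_comm]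
    congr 1
    simp only [List.map_const', List.sum_replicate, smul_eq_mul]
    rw [Nat.cast_list_sum, List.map_map]
    rfl
  · intro w hw
    refine le_trans ?_ (hb w)
    rw [one_mul, ← Nat.cast_add, Nat.cast_le]
    have := Nat.mul_le_mul_left (d + 1) (length_bucket_build_le (p := p) (α := α) (δ := δ) S h r w j)
    rw [mul_comm _ (d + 1)]
    omega

lemma space_build_le (S : Fin n → Fin d → Bool) (h : Fin L → Fin T → Hash d) :
    ((build p α δ S h).space : ENNReal) ≤ ((n * d + d + 2 * (L * T) : ℕ) : ENNReal)
      + ∑ r, ∑ y, treeSum n p α δ 0 (fun _ => ((T + 2 : ℕ) : ENNReal)) (S y)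
        (List.ofFn (h r)) [] := by
  simp only [DataStructure.space, build]
  rw [Nat.cast_add]
  gcongr
  rw [List.map_flatMap, sum_flatMap, ← Fin.sum_univ_def, Nat.cast_sum]
  refine Finset.sum_le_sum fun r _ => ?_
  rw [List.map_flatMap, sum_flatMap, ← Fin.sum_univ_def, Nat.cast_sum]
  refine Finset.sum_le_sum fun y _ => ?_
  refine le_trans (le_of_eq ?_) (explore_le_treeSum (T := T) (s := 0) (a := 0)
    (b := fun _ => ((T + 2 : ℕ) : ENNReal))
    (g := fun f => ((f.length + 2 : ℕ) : ENNReal)) (by simp) ?_ (S y) (List.ofFn (h r)) []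
    (by simp))
  · rw [zero_mul, zero_add, List.map_map, Nat.cast_list_sum, List.map_map]
    rfl
  · intro w hw
    rw [zero_mul, zero_add, Nat.cast_le]
    omega

/-- The search returns the `j`-th vector if it shares a filter with the query and all other
vectors are less similar to the query. -/
lemma val_search_eq_some {S : Fin n → Fin d → Bool} {h : Fin L → Fin T → Hash d}
    {q : Fin d → Bool} {j : Fin n}
    (hf : ∃ r, ∃ f, f ∈ (filters n p α δ (h r) q).val ∧ f ∈ (filters n p α δ (h r) (S j)).val)
    (hs : ∀ k, k ≠ j → similarity (S k) q < similarity (S j) q) :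
    ((build p α δ S h).search p α δ q).val = some j := by
  obtain ⟨r, f, hfq, hfj⟩ := hf
  simp only [DataStructure.search, Timed.collect, Timed.tick]
  set l : List (Fin n) := List.flatMap _ _ with hl
  have hjl : j ∈ l := by
    rw [hl]
    simp only [List.mem_flatMap, List.mem_singleton]
    exact ⟨r, List.mem_finRange r, f, hfq, j, mem_bucket_build.2 hfj, rfl⟩
  change List.argmax (fun y => similarity (S y) q) l = some j
  obtain ⟨k, hk⟩ : ∃ k, List.argmax (fun y => similarity (S y) q) l = some k := by
    rw [← Option.ne_none_iff_exists']
    intro h0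
    rw [List.argmax_eq_none] at h0
    rw [h0] at hjl
    simp at hjl
  rw [hk]
  by_contra hne
  have h1 := List.le_of_mem_argmax hjl hk
  exact absurd h1 (not_le.2 (hs k fun e => hne (by rw [e])))

end Index

/-! ### Expectations over the hash functions -/

section HashExpectation

variable {d : ℕ} {𝓗 : Measure (Hash d)}

lemma IsPairwiseIndepHash.lt_le (h𝓗 : IsPairwiseIndepHash 𝓗) (v : List (Fin d)) (t : ℝ) :
    𝓗 {h | h v < t} ≤ ENNReal.ofReal t := by
  have h1 : 𝓗 {h | h v < t} = (𝓗.map fun h => h v) (Set.Iio t) := by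
    rw [Measure.map_apply (measurable_pi_apply v) measurableSet_Iio]
    rfl
  rw [h1, h𝓗.uniform, Measure.restrict_apply measurableSet_Iio]
  calc volume (Set.Iio t ∩ Set.Icc 0 1) ≤ volume (Set.Ico 0 t) :=
        measure_mono fun y hy => ⟨hy.2.1, hy.1⟩
    _ = ENNReal.ofReal t := by rw [Real.volume_Ico, sub_zero]

lemma IsPairwiseIndepHash.lt_eq (h𝓗 : IsPairwiseIndepHash 𝓗) (v : List (Fin d)) {t : ℝ}
    (ht : t ≤ 1) : 𝓗 {h | h v < t} = ENNReal.ofReal t := by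
  refine le_antisymm (h𝓗.lt_le v t) ?_
  have h1 : 𝓗 {h | h v < t} = (𝓗.map fun h => h v) (Set.Iio t) := by
    rw [Measure.map_apply (measurable_pi_apply v) measurableSet_Iio]
    rfl
  rw [h1, h𝓗.uniform, Measure.restrict_apply measurableSet_Iio]
  calc ENNReal.ofReal t = volume (Set.Ico 0 t) := by rw [Real.volume_Ico, sub_zero]
    _ ≤ volume (Set.Iio t ∩ Set.Icc 0 1) :=
        measure_mono fun y hy => ⟨hy.2, hy.1, hy.2.le.trans ht⟩

lemma IsPairwiseIndepHash.lt_inter (h𝓗 : IsPairwiseIndepHash 𝓗) {v w : List (Fin d)}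
    (hvw : v ≠ w) {s t : ℝ} (hs : s ≤ 1) (ht : t ≤ 1) :
    𝓗 ({h | h v < s} ∩ {h | h w < t}) = ENNReal.ofReal s * ENNReal.ofReal t := by
  have h1 := (h𝓗.indep v w hvw).measure_inter_preimage_eq_mul (Set.Iio s) (Set.Iio t)
    measurableSet_Iio measurableSet_Iio
  rw [← h𝓗.lt_eq v hs, ← h𝓗.lt_eq w ht]
  exact h1

/-- The hash function of the first level is independent of those of the later levels. -/
lemma lintegral_pi_succ [IsProbabilityMeasure 𝓗] {T : ℕ}
    {F : Hash d → (Fin T → Hash d) → ENNReal} (hF : Measurable fun t : Hash d × _ => F t.1 t.2) :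
    ∫⁻ h : Fin (T + 1) → Hash d, F (h 0) (fun i => h i.succ) ∂(Measure.pi fun _ => 𝓗)
      = ∫⁻ t, F t.1 t.2 ∂(𝓗.prod (Measure.pi fun _ => 𝓗)) := by
  have h := (measurePreserving_piFinSuccAbove (fun _ : Fin (T + 1) => 𝓗) 0).lintegral_comp hF
  rw [← h]
  rfl

section FirstMoment

variable {n : ℕ} {p : Fin d → ℝ} {α δ : ℝ} {a : ENNReal} {b : List (Fin d) → ENNReal}
  {x : Fin d → Bool}

lemma measurable_treeSum (T : ℕ) (v : List (Fin d)) :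
    Measurable fun h : Fin T → Hash d => treeSum n p α δ a b x (List.ofFn h) v := by
  induction T generalizing v with
  | zero => simp only [List.ofFn_zero]; exact measurable_const
  | succ T ih =>
    simp only [List.ofFn_succ, treeSum]
    split_ifs
    · exact measurable_const
    · refine measurable_const.add (Finset.measurable_fun_sum _ fun i _ => ?_)
      refine Measurable.ite ?_ ?_ measurable_const
      · refine (MeasurableSet.const _).inter ((MeasurableSet.const _).inter ?_)
        exact measurableSet_lt (f := fun h : Fin (T + 1) → Hash d => h 0 (i :: v)) (by fun_prop)
          measurable_const
      · exact (ih (i :: v)).comp (by fun_prop)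

open Classical in
/-- An upper bound for the expectation of a tree sum over `T` random hash functions: each
extension of a path is weighted with its threshold. -/
noncomputable def expTreeSum {d : ℕ} (n : ℕ) (p : Fin d → ℝ) (α δ : ℝ) (a : ENNReal)
    (b : List (Fin d) → ENNReal) (x : Fin d → Bool) : ℕ → List (Fin d) → ENNReal
  | 0, v => if Complete n p v then b v else a
  | T + 1, v =>
      if Complete n p v then b v
      else a + ∑ i, if x i = true ∧ i ∉ v then
        ENNReal.ofReal (threshold p α δ v.length i) * expTreeSum n p α δ a b x T (i :: v) else 0

lemma lintegral_treeSum_le (h𝓗 : IsPairwiseIndepHash 𝓗) (T : ℕ) (v : List (Fin d)) :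
    ∫⁻ h : Fin T → Hash d, treeSum n p α δ a b x (List.ofFn h) v ∂(Measure.pi fun _ => 𝓗)
      ≤ expTreeSum n p α δ a b x T v := by
  have := h𝓗.isProbabilityMeasure
  induction T generalizing v with
  | zero =>
    simp only [List.ofFn_zero, expTreeSum, treeSum]
    rw [lintegral_const]
    simp
  | succ T ih =>
    simp only [List.ofFn_succ, treeSum, expTreeSum]
    split_ifs with hc
    · rw [lintegral_const]
      simp
    · have hm : ∀ i, Measurable fun t : Hash d × (Fin T → Hash d) =>
          if x i = true ∧ i ∉ v ∧ t.1 (i :: v) < threshold p α δ v.length i then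
            treeSum n p α δ a b x (List.ofFn t.2) (i :: v) else 0 := by
        intro i
        refine Measurable.ite ?_ ?_ measurable_const
        · refine (MeasurableSet.const _).inter ((MeasurableSet.const _).inter ?_)
          exact measurableSet_lt (f := fun t : Hash d × (Fin T → Hash d) => t.1 (i :: v))
            (by fun_prop) measurable_const
        · exact (measurable_treeSum T (i :: v)).comp (by fun_prop)
      rw [lintegral_pi_succ (F := fun g hs => a + ∑ i,
        if x i = true ∧ i ∉ v ∧ g (i :: v) < threshold p α δ v.length i then
          treeSum n p α δ a b x (List.ofFn hs) (i :: v) else 0)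
        (measurable_const.add (Finset.measurable_fun_sum _ fun i _ => hm i)),
        lintegral_add_left measurable_const, lintegral_const, measure_univ, mul_one,
        lintegral_finsetSum _ fun i _ => hm i]
      gcongr with i
      split_ifs with hi
      · rw [lintegral_prod _ (hm i).aemeasurable]
        calc _ = ∫⁻ g, ({g : Hash d | g (i :: v) < threshold p α δ v.length i}.indicator 1 g)
              * ∫⁻ hs : Fin T → Hash d, treeSum n p α δ a b x (List.ofFn hs) (i :: v)
                ∂(Measure.pi fun _ => 𝓗) ∂𝓗 := by
              refine lintegral_congr fun g => ?_
              by_cases hg : g (i :: v) < threshold p α δ v.length i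
              · simp [hi.1, hi.2, hg]
              · simp [hg]
          _ = 𝓗 {g : Hash d | g (i :: v) < threshold p α δ v.length i}
              * ∫⁻ hs : Fin T → Hash d, treeSum n p α δ a b x (List.ofFn hs) (i :: v)
                ∂(Measure.pi fun _ => 𝓗) := by
              have hs : MeasurableSet {g : Hash d | g (i :: v) < threshold p α δ v.length i} :=
                measurableSet_lt (by fun_prop) measurable_const
              rw [lintegral_mul_const _ (measurable_one.indicator hs),
                lintegral_indicator_one hs]
          _ ≤ _ := mul_le_mul' (h𝓗.lt_le _ _) (ih _)
      · have : ∀ t : Hash d × (Fin T → Hash d),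
            ¬ (x i = true ∧ i ∉ v ∧ t.1 (i :: v) < threshold p α δ v.length i) :=
          fun t ht => hi ⟨ht.1, ht.2.1⟩
        simp [this]

end FirstMoment

/-! ### The second moment method -/

section SecondMoment

variable {n : ℕ} {p : Fin d → ℝ} {A : Fin d → Bool} {t : List (Fin d) → Fin d → ℝ}

open Classical in
/-- The number of complete paths below `v` inside `A` that are found with the thresholds `t`. -/
noncomputable def pathCount {d : ℕ} (n : ℕ) (p : Fin d → ℝ) (A : Fin d → Bool)
    (t : List (Fin d) → Fin d → ℝ) : List (Hash d) → List (Fin d) → ℕ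
  | [], v => if Complete n p v then 1 else 0
  | h :: hs, v =>
      if Complete n p v then 1
      else ∑ i, if A i = true ∧ i ∉ v ∧ h (i :: v) < t v i then
        pathCount n p A t hs (i :: v) else 0

/-- If a path is found in `x ∩ q` with thresholds below the true ones, then it is a common filter
of `x` and `q`. -/
lemma exists_mem_explore_of_pathCount_ne_zero {α δ : ℝ} {x q : Fin d → Bool} {T : ℕ}
    (hx : ∀ i, A i = true → x i = true) (hq : ∀ i, A i = true → q i = true)
    (ht : ∀ v i, v.length < T → A i = true → i ∉ v → t v i ≤ threshold p α δ v.length i)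
    {hs : List (Hash d)} {v : List (Fin d)} (hv : v.length + hs.length ≤ T)
    (h0 : pathCount n p A t hs v ≠ 0) :
    ∃ f, f ∈ (explore n p α δ q hs v).val ∧ f ∈ (explore n p α δ x hs v).val := by
  induction hs generalizing v with
  | nil =>
    simp only [pathCount] at h0
    split_ifs at h0 with hc
    · simp [explore, hc]
    · simp at h0
  | cons h hs ih =>
    simp only [pathCount] at h0
    simp only [List.length_cons] at hv
    split_ifs at h0 with hc
    · simp [explore, hc]
    · obtain ⟨i, -, hi⟩ := Finset.exists_ne_zero_of_sum_ne_zero h0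
      split_ifs at hi with hcond
      · obtain ⟨hA, hiv, hlt⟩ := hcond
        obtain ⟨f, hf1, hf2⟩ := ih (by simp only [List.length_cons]; omega) hi
        have hlt' := hlt.trans_le (ht v i (by omega) hA hiv)
        refine ⟨f, ?_, ?_⟩
        · simp only [explore, hc, if_false, Timed.tick, Timed.collect, List.mem_flatMap]
          refine ⟨i, List.mem_finRange i, ?_⟩
          rw [if_pos ⟨hq i hA, hiv, hlt'⟩]
          exact hf1
        · simp only [explore, hc, if_false, Timed.tick, Timed.collect, List.mem_flatMap]
          refine ⟨i, List.mem_finRange i, ?_⟩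
          rw [if_pos ⟨hx i hA, hiv, hlt'⟩]
          exact hf2
      · exact absurd rfl hi

/-- The event that the path `v` is extended by `i` inside `A`. -/
def extendEvent {d : ℕ} (A : Fin d → Bool) (t : List (Fin d) → Fin d → ℝ) (v : List (Fin d))
    (i : Fin d) : Set (Hash d) := {h | A i = true ∧ i ∉ v ∧ h (i :: v) < t v i}

lemma measurableSet_extendEvent (v : List (Fin d)) (i : Fin d) :
    MeasurableSet (extendEvent A t v i) :=
  (MeasurableSet.const _).inter ((MeasurableSet.const _).inter
    (measurableSet_lt (f := fun h : Hash d => h (i :: v)) (by fun_prop) measurable_const))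

/-- The thresholds `t` turn the tree of paths inside `A` with fewer than `T` coordinates into a
critical branching process: the expected number of extensions of each path is one. -/
structure IsCritical {d : ℕ} (A : Fin d → Bool) (t : List (Fin d) → Fin d → ℝ) (T : ℕ) : Prop where
  nonneg : ∀ v i, v.length < T → 0 ≤ t v i
  eq_zero : ∀ v i, v.length < T → ¬ (A i = true ∧ i ∉ v) → t v i = 0
  sum_eq_one : ∀ v, v.length < T → ∑ i, t v i = 1

lemma IsCritical.le_one {T : ℕ} (ht : IsCritical A t T) {v : List (Fin d)} (hv : v.length < T)
    (i : Fin d) : t v i ≤ 1 := by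
  rw [← ht.sum_eq_one v hv]
  exact Finset.single_le_sum (fun k _ => ht.nonneg v k hv) (Finset.mem_univ i)

lemma IsCritical.sum_ofReal {T : ℕ} (ht : IsCritical A t T) {v : List (Fin d)}
    (hv : v.length < T) : ∑ i, ENNReal.ofReal (t v i) = 1 := by
  rw [← ENNReal.ofReal_sum_of_nonneg fun i _ => ht.nonneg v i hv, ht.sum_eq_one v hv,
    ENNReal.ofReal_one]

lemma extendEvent_subset (v : List (Fin d)) (i : Fin d) :
    extendEvent A t v i ⊆ {h | h (i :: v) < t v i} := fun _ h => h.2.2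

lemma measure_extendEvent (h𝓗 : IsPairwiseIndepHash 𝓗) {T : ℕ} (ht : IsCritical A t T)
    {v : List (Fin d)} (hv : v.length < T) (i : Fin d) :
    𝓗 (extendEvent A t v i) = ENNReal.ofReal (t v i) := by
  by_cases hi : A i = true ∧ i ∉ v
  · rw [← h𝓗.lt_eq (i :: v) (ht.le_one hv i)]
    congr 1
    ext h
    simp [extendEvent, hi.1, hi.2]
  · rw [ht.eq_zero v i hv hi, ENNReal.ofReal_zero]
    convert measure_empty (μ := 𝓗)
    ext h
    simp only [extendEvent, Set.mem_ofPred_eq, Set.mem_empty_iff_false, iff_false]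
    tauto

lemma measure_extendEvent_inter_le (h𝓗 : IsPairwiseIndepHash 𝓗) {T : ℕ}
    (ht : IsCritical A t T) {v w : List (Fin d)} (hv : v.length < T) (hw : w.length < T)
    {i k : Fin d} (hne : i :: v ≠ k :: w) :
    𝓗 (extendEvent A t v i ∩ extendEvent A t w k)
      ≤ ENNReal.ofReal (t v i) * ENNReal.ofReal (t w k) := by
  rw [← h𝓗.lt_inter hne (ht.le_one hv i) (ht.le_one hw k)]
  exact measure_mono (Set.inter_subset_inter (extendEvent_subset v i) (extendEvent_subset w k))

lemma pathCount_of_complete {v : List (Fin d)} (hc : Complete n p v) (hs : List (Hash d)) :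
    pathCount n p A t hs v = 1 := by
  cases hs <;> simp [pathCount, hc]

lemma pathCount_cons {v : List (Fin d)} (hc : ¬ Complete n p v) (h : Hash d)
    (hs : List (Hash d)) :
    (pathCount n p A t (h :: hs) v : ENNReal)
      = ∑ i, (extendEvent A t v i).indicator 1 h * (pathCount n p A t hs (i :: v) : ENNReal) := by
  simp only [pathCount, hc, if_false, Nat.cast_sum]
  refine Finset.sum_congr rfl fun i _ => ?_
  simp only [extendEvent, Set.indicator_apply, Set.mem_ofPred_eq, Pi.one_apply]
  split_ifs <;> simp

lemma measurable_pathCount (T : ℕ) (v : List (Fin d)) :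
    Measurable fun h : Fin T → Hash d => (pathCount n p A t (List.ofFn h) v : ENNReal) := by
  induction T generalizing v with
  | zero => simp only [List.ofFn_zero]; exact measurable_const
  | succ T ih =>
    by_cases hc : Complete n p v
    · simp only [pathCount_of_complete hc]
      exact measurable_const
    · simp only [List.ofFn_succ, pathCount_cons hc]
      refine Finset.measurable_fun_sum _ fun i _ => ?_
      refine Measurable.mul ?_ ((ih (i :: v)).comp (by fun_prop))
      exact (measurable_one.indicator (measurableSet_extendEvent v i)).comp (by fun_prop)

/-- In the critical process every path has exactly one complete extension on average. -/
lemma lintegral_pathCount (h𝓗 : IsPairwiseIndepHash 𝓗) {T₀ : ℕ} (ht : IsCritical A t T₀)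
    (hcomp : ∀ v : List (Fin d), v.length = T₀ → Complete n p v) (T : ℕ) (v : List (Fin d))
    (hv : v.length + T = T₀) :
    ∫⁻ h : Fin T → Hash d, (pathCount n p A t (List.ofFn h) v : ENNReal)
      ∂(Measure.pi fun _ => 𝓗) = 1 := by
  have := h𝓗.isProbabilityMeasure
  induction T generalizing v with
  | zero =>
    simp only [pathCount_of_complete (hcomp v hv)]
    simp
  | succ T ih =>
    by_cases hc : Complete n p v
    · simp only [pathCount_of_complete hc]
      simp
    · simp only [List.ofFn_succ, pathCount_cons hc]
      have hm : ∀ i, Measurable fun s : Hash d × (Fin T → Hash d) =>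
          (extendEvent A t v i).indicator (1 : Hash d → ENNReal) s.1
            * (pathCount n p A t (List.ofFn s.2) (i :: v) : ENNReal) := fun i =>
        ((measurable_one.indicator (measurableSet_extendEvent v i)).comp measurable_fst).mul
          ((measurable_pathCount T (i :: v)).comp measurable_snd)
      rw [lintegral_pi_succ (F := fun g hs => ∑ i,
          (extendEvent A t v i).indicator 1 g
            * (pathCount n p A t (List.ofFn hs) (i :: v) : ENNReal))
          (Finset.measurable_fun_sum _ fun i _ => hm i),
        lintegral_finsetSum _ fun i _ => hm i, ← ht.sum_ofReal (v := v) (by omega)]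
      refine Finset.sum_congr rfl fun i _ => ?_
      rw [lintegral_prod_mul (measurable_one.indicator
          (measurableSet_extendEvent v i)).aemeasurable
          (measurable_pathCount T (i :: v)).aemeasurable,
        lintegral_indicator_one (measurableSet_extendEvent v i),
        ih (i :: v) (by simp only [List.length_cons]; omega), mul_one,
        measure_extendEvent h𝓗 ht (by omega)]

/-- Conditioning on the first level: two paths of equal length are extended independently of what
happens on the later levels. -/
lemma lintegral_pathCount_mul_succ [IsProbabilityMeasure 𝓗] (T : ℕ) {v w : List (Fin d)}
    (hcv : ¬ Complete n p v) (hcw : ¬ Complete n p w) :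
    ∫⁻ h : Fin (T + 1) → Hash d, (pathCount n p A t (List.ofFn h) v : ENNReal)
        * (pathCount n p A t (List.ofFn h) w : ENNReal) ∂(Measure.pi fun _ => 𝓗)
      = ∑ i, ∑ k, 𝓗 (extendEvent A t v i ∩ extendEvent A t w k)
        * ∫⁻ h : Fin T → Hash d, (pathCount n p A t (List.ofFn h) (i :: v) : ENNReal)
          * (pathCount n p A t (List.ofFn h) (k :: w) : ENNReal) ∂(Measure.pi fun _ => 𝓗) := by
  have hms : ∀ i k, MeasurableSet (extendEvent A t v i ∩ extendEvent A t w k) := fun i k =>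
    (measurableSet_extendEvent v i).inter (measurableSet_extendEvent w k)
  have hmc : ∀ i k, Measurable fun h : Fin T → Hash d =>
      (pathCount n p A t (List.ofFn h) (i :: v) : ENNReal)
        * (pathCount n p A t (List.ofFn h) (k :: w) : ENNReal) := fun i k =>
    (measurable_pathCount T (i :: v)).mul (measurable_pathCount T (k :: w))
  have hm : ∀ i k, Measurable fun s : Hash d × (Fin T → Hash d) =>
      (extendEvent A t v i ∩ extendEvent A t w k).indicator (1 : Hash d → ENNReal) s.1
        * ((pathCount n p A t (List.ofFn s.2) (i :: v) : ENNReal)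
          * (pathCount n p A t (List.ofFn s.2) (k :: w) : ENNReal)) := fun i k =>
    ((measurable_one.indicator (hms i k)).comp measurable_fst).mul
      ((hmc i k).comp measurable_snd)
  have hm1 : ∀ i, Measurable fun s : Hash d × (Fin T → Hash d) => ∑ k,
      (extendEvent A t v i ∩ extendEvent A t w k).indicator (1 : Hash d → ENNReal) s.1
        * ((pathCount n p A t (List.ofFn s.2) (i :: v) : ENNReal)
          * (pathCount n p A t (List.ofFn s.2) (k :: w) : ENNReal)) := fun i =>
    Finset.measurable_fun_sum _ fun k _ => hm i k
  have hm2 := Finset.measurable_fun_sum (Finset.univ : Finset (Fin d)) fun i _ => hm1 i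
  set F : Hash d → (Fin T → Hash d) → ENNReal := fun g hs => ∑ i, ∑ k,
    (extendEvent A t v i ∩ extendEvent A t w k).indicator (1 : Hash d → ENNReal) g
      * ((pathCount n p A t (List.ofFn hs) (i :: v) : ENNReal)
        * (pathCount n p A t (List.ofFn hs) (k :: w) : ENNReal)) with hF
  calc _ = ∫⁻ h : Fin (T + 1) → Hash d, F (h 0) (fun i => h i.succ)
          ∂(Measure.pi fun _ => 𝓗) := by
        refine lintegral_congr fun h => ?_
        rw [hF, List.ofFn_succ, pathCount_cons hcv, pathCount_cons hcw, Finset.sum_mul_sum]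
        refine Finset.sum_congr rfl fun i _ => Finset.sum_congr rfl fun k _ => ?_
        rw [Set.inter_indicator_one, Pi.mul_apply]
        ring
    _ = _ := by
        rw [lintegral_pi_succ (F := F) hm2, lintegral_finsetSum _ fun i _ => hm1 i]
        refine Finset.sum_congr rfl fun i _ => ?_
        rw [lintegral_finsetSum _ fun k _ => hm i k]
        refine Finset.sum_congr rfl fun k _ => ?_
        rw [lintegral_prod_mul (measurable_one.indicator (hms i k)).aemeasurable
          (hmc i k).aemeasurable, lintegral_indicator_one (hms i k)]

/-- Different paths of equal length have uncorrelated numbers of complete extensions, and the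
second moment of a single such number grows at most linearly with the number of levels. -/
lemma lintegral_pathCount_mul_le (h𝓗 : IsPairwiseIndepHash 𝓗) {T₀ : ℕ} (ht : IsCritical A t T₀)
    (hcomp : ∀ v : List (Fin d), v.length = T₀ → Complete n p v) (T : ℕ) (v w : List (Fin d))
    (hv : v.length + T = T₀) (hw : w.length + T = T₀) :
    ∫⁻ h : Fin T → Hash d, (pathCount n p A t (List.ofFn h) v : ENNReal)
        * (pathCount n p A t (List.ofFn h) w : ENNReal) ∂(Measure.pi fun _ => 𝓗)
      ≤ if v = w then ((T + 1 : ℕ) : ENNReal) else 1 := by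
  have := h𝓗.isProbabilityMeasure
  have hone : ∀ T : ℕ, (1 : ENNReal) ≤ if v = w then ((T + 1 : ℕ) : ENNReal) else 1 := by
    intro T
    split_ifs
    · exact_mod_cast Nat.le_add_left 1 T
    · exact le_rfl
  by_cases hcv : Complete n p v
  · simp only [pathCount_of_complete hcv, Nat.cast_one, one_mul]
    rw [lintegral_pathCount h𝓗 ht hcomp T w hw]
    exact hone T
  by_cases hcw : Complete n p w
  · simp only [pathCount_of_complete hcw, Nat.cast_one, mul_one]
    rw [lintegral_pathCount h𝓗 ht hcomp T v hv]
    exact hone T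
  induction T generalizing v w with
  | zero => exact absurd (hcomp v hv) hcv
  | succ T ih =>
    -- the induction hypothesis without the assumption of incompleteness
    have ih' : ∀ i k : Fin d,
        ∫⁻ h : Fin T → Hash d, (pathCount n p A t (List.ofFn h) (i :: v) : ENNReal)
          * (pathCount n p A t (List.ofFn h) (k :: w) : ENNReal) ∂(Measure.pi fun _ => 𝓗)
        ≤ if i :: v = k :: w then ((T + 1 : ℕ) : ENNReal) else 1 := by
      intro i k
      have hv' : (i :: v).length + T = T₀ := by simp only [List.length_cons]; omega
      have hw' : (k :: w).length + T = T₀ := by simp only [List.length_cons]; omega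
      have hone' : ∀ T : ℕ, (1 : ENNReal)
          ≤ if i :: v = k :: w then ((T + 1 : ℕ) : ENNReal) else 1 := by
        intro T
        split_ifs
        · exact_mod_cast Nat.le_add_left 1 T
        · exact le_rfl
      by_cases h1 : Complete n p (i :: v)
      · simp only [pathCount_of_complete h1, Nat.cast_one, one_mul]
        rw [lintegral_pathCount h𝓗 ht hcomp T _ hw']
        exact hone' T
      by_cases h2 : Complete n p (k :: w)
      · simp only [pathCount_of_complete h2, Nat.cast_one, mul_one]
        rw [lintegral_pathCount h𝓗 ht hcomp T _ hv']
        exact hone' T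
      exact ih _ _ hv' hw' hone' h1 h2
    have hvT : v.length < T₀ := by omega
    have hwT : w.length < T₀ := by omega
    rw [lintegral_pathCount_mul_succ T hcv hcw]
    calc _ ≤ ∑ i, ∑ k, (ENNReal.ofReal (t v i) * ENNReal.ofReal (t w k)
            + if i :: v = k :: w then ENNReal.ofReal (t v i) * ((T + 1 : ℕ) : ENNReal) else 0) := by
          refine Finset.sum_le_sum fun i _ => Finset.sum_le_sum fun k _ => ?_
          refine (mul_le_mul' le_rfl (ih' i k)).trans ?_
          split_ifs with hik
          · refine le_add_left (mul_le_mul' ?_ le_rfl)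
            rw [← measure_extendEvent h𝓗 ht hvT i]
            exact measure_mono Set.inter_subset_left
          · rw [mul_one, add_zero]
            exact measure_extendEvent_inter_le h𝓗 ht hvT hwT hik
      _ = (∑ i, ENNReal.ofReal (t v i)) * (∑ k, ENNReal.ofReal (t w k))
            + ∑ i, ∑ k, if i :: v = k :: w then
              ENNReal.ofReal (t v i) * ((T + 1 : ℕ) : ENNReal) else 0 := by
          rw [Finset.sum_mul_sum, ← Finset.sum_add_distrib]
          refine Finset.sum_congr rfl fun i _ => ?_
          rw [Finset.sum_add_distrib]
      _ ≤ _ := by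
          rw [ht.sum_ofReal hvT, ht.sum_ofReal hwT, one_mul]
          by_cases hvw : v = w
          · subst hvw
            simp only [List.cons.injEq, and_true, if_true, Finset.sum_ite_eq, Finset.mem_univ]
            rw [← Finset.sum_mul, ht.sum_ofReal hvT, one_mul]
            push_cast
            rw [add_comm]
          · simp [hvw]

/-- By the second moment method, some path is found with probability at least `1 / (T + 1)`. -/
lemma measure_pathCount_eq_zero_le (h𝓗 : IsPairwiseIndepHash 𝓗) {T : ℕ} (ht : IsCritical A t T)
    (hcomp : ∀ v : List (Fin d), v.length = T → Complete n p v) :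
    (Measure.pi fun _ : Fin T => 𝓗) {h | pathCount n p A t (List.ofFn h) [] = 0}
      ≤ ENNReal.ofReal (1 - 1 / (T + 1)) := by
  have := h𝓗.isProbabilityMeasure
  set μ := (Measure.pi fun _ : Fin T => 𝓗) with hμ
  set V : (Fin T → Hash d) → ℕ := fun h => pathCount n p A t (List.ofFn h) [] with hV
  have hVm : Measurable fun h => (V h : ENNReal) := measurable_pathCount T []
  have hE1 : ∫⁻ h, (V h : ENNReal) ∂μ = 1 :=
    lintegral_pathCount h𝓗 ht hcomp T [] (by simp)
  have hE2 : ∫⁻ h, (V h : ENNReal) * (V h : ENNReal) ∂μ ≤ ((T + 1 : ℕ) : ENNReal) := by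
    simpa using lintegral_pathCount_mul_le h𝓗 ht hcomp T [] [] (by simp) (by simp)
  have hS : MeasurableSet {h | V h ≠ 0} := by
    have : {h | V h ≠ 0} = (fun h => (V h : ENNReal)) ⁻¹' {0}ᶜ := by ext h; simp
    rw [this]
    exact hVm (measurableSet_singleton 0).compl
  set M : ℕ := T + 1 with hM
  -- integrate `2 M V ≤ V ^ 2 + M ^ 2 1_{V ≠ 0}`
  have hpt : ∀ h, ((2 * M : ℕ) : ENNReal) * (V h : ENNReal)
      ≤ (V h : ENNReal) * (V h : ENNReal)
        + ((M * M : ℕ) : ENNReal) * {h | V h ≠ 0}.indicator 1 h := by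
    intro h
    by_cases h0 : V h = 0
    · simp [h0]
    · rw [Set.indicator_of_mem (show h ∈ {h | V h ≠ 0} from h0), Pi.one_apply, mul_one,
        ← Nat.cast_mul, ← Nat.cast_mul, ← Nat.cast_add, Nat.cast_le]
      have := two_mul_le_add_sq (M : ℤ) (V h : ℤ)
      zify
      nlinarith
  have hint := lintegral_mono (μ := μ) hpt
  rw [lintegral_const_mul _ hVm, lintegral_add_left (f := fun h => (V h : ENNReal) * (V h : ENNReal)) (hVm.mul hVm),
    lintegral_const_mul _ (measurable_one.indicator hS), lintegral_indicator_one hS, hE1,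
    mul_one] at hint
  have hint2 := hint.trans (add_le_add hE2 le_rfl)
  have hfin : μ {h | V h ≠ 0} ≠ ⊤ := measure_ne_top _ _
  have hreal : ((2 * M : ℕ) : ℝ) ≤ M + (M * M : ℕ) * μ.real {h | V h ≠ 0} := by
    have h1 := ENNReal.toReal_mono (by finiteness) hint2
    rw [ENNReal.toReal_add (by finiteness) (by finiteness), ENNReal.toReal_mul] at h1
    simpa [Measure.real] using h1
  have hMpos : (0 : ℝ) < M := by rw [hM]; positivity
  have hge : 1 / (M : ℝ) ≤ μ.real {h | V h ≠ 0} := by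
    rw [div_le_iff₀ hMpos]
    push_cast at hreal
    have : (M : ℝ) * 1 ≤ M * (μ.real {h | V h ≠ 0} * M) := by nlinarith
    exact le_of_mul_le_mul_left this hMpos
  have hc : {h | V h = 0} = {h | V h ≠ 0}ᶜ := by ext h; simp
  rw [hc, ← ofReal_measureReal, probReal_compl_eq_one_sub hS]
  apply ENNReal.ofReal_le_ofReal
  rw [hM] at hge
  push_cast at hge
  linarith

lemma measure_forall_pathCount_eq_zero_le (h𝓗 : IsPairwiseIndepHash 𝓗) {T : ℕ}
    (ht : IsCritical A t T) (hcomp : ∀ v : List (Fin d), v.length = T → Complete n p v) (L : ℕ) :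
    (Measure.pi fun _ : Fin L => Measure.pi fun _ : Fin T => 𝓗)
      {h | ∀ r, pathCount n p A t (List.ofFn (h r)) [] = 0}
      ≤ ENNReal.ofReal ((1 - 1 / (T + 1)) ^ L) := by
  have := h𝓗.isProbabilityMeasure
  have : {h : Fin L → Fin T → Hash d | ∀ r, pathCount n p A t (List.ofFn (h r)) [] = 0}
      = Set.univ.pi fun _ => {h | pathCount n p A t (List.ofFn h) [] = 0} := by
    ext h; simp
  have h1 : (0 : ℝ) ≤ 1 - 1 / (T + 1) := by
    rw [sub_nonneg, div_le_one (by positivity)]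
    have : (0 : ℝ) ≤ T := T.cast_nonneg
    linarith
  rw [this, Measure.pi_pi, Finset.prod_const, Finset.card_univ, Fintype.card_fin,
    ENNReal.ofReal_pow h1]
  exact pow_le_pow_left' (measure_pathCount_eq_zero_le h𝓗 ht hcomp) L

end SecondMoment

end HashExpectation

/-! ### Joint distribution of data, query and hash functions -/

section SampleLaw

variable {n d : ℕ} {p : Fin d → ℝ} {α : ℝ}

/-- The random choices other than the hash functions: data vectors, noise and coins. -/
abbrev Inputs (n d : ℕ) : Type := (Fin n → Fin d → Bool) × (Fin d → Bool) × (Fin d → Bool)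

/-- The law of data vectors, noise and coins. -/
noncomputable def inputLaw (n : ℕ) {d : ℕ} (p : Fin d → ℝ) (α : ℝ) : Measure (Inputs n d) :=
  (Measure.pi fun _ : Fin n => vecLaw p).prod ((vecLaw p).prod (vecLaw fun _ : Fin d => α))

/-- The query that is correlated with the `j`-th data vector. -/
def Inputs.query {n d : ℕ} (ω : Inputs n d) (j : Fin n) : Fin d → Bool :=
  correlate (ω.1 j) ω.2.1 ω.2.2

lemma isProbabilityMeasure_inputLaw (n : ℕ) (hp : ∀ i, 0 ≤ p i ∧ p i ≤ 1)
    (hα : 0 ≤ α ∧ α ≤ 1) : IsProbabilityMeasure (inputLaw n p α) := by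
  have := isProbabilityMeasure_vecLaw hp
  have := isProbabilityMeasure_vecLaw (d := d) (p := fun _ => α) fun _ => hα
  unfold inputLaw
  infer_instance

lemma measurable_sample {L T : ℕ} {G : Inputs n d → (Fin L → Fin T → Hash d) → ENNReal}
    (hG : ∀ ω, Measurable (G ω)) :
    Measurable fun t : RawSample n d L T => G (t.1, t.2.1, t.2.2.1) t.2.2.2 := by
  have h1 : Measurable fun t : Inputs n d × (Fin L → Fin T → Hash d) => G t.1 t.2 :=
    measurable_from_prod_countable_right hG
  exact h1.comp (g := fun t : Inputs n d × (Fin L → Fin T → Hash d) => G t.1 t.2)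
    (f := fun t : RawSample n d L T => ((t.1, t.2.1, t.2.2.1), t.2.2.2)) (by fun_prop)

/-- The hash functions are independent of data, noise and coins. -/
lemma lintegral_sampleLaw {L T : ℕ} {𝓗 : Measure (Hash d)} [IsProbabilityMeasure 𝓗]
    {G : Inputs n d → (Fin L → Fin T → Hash d) → ENNReal} (hG : ∀ ω, Measurable (G ω)) :
    ∫⁻ t, G (t.1, t.2.1, t.2.2.1) t.2.2.2 ∂(sampleLaw n L T p α 𝓗)
      = ∫⁻ ω, ∫⁻ h, G ω h ∂(Measure.pi fun _ : Fin L => Measure.pi fun _ : Fin T => 𝓗)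
        ∂(inputLaw n p α) := by
  have hm := measurable_sample hG
  unfold sampleLaw inputLaw
  rw [lintegral_prod _ hm.aemeasurable, lintegral_prod _ (measurable_of_finite _).aemeasurable]
  refine lintegral_congr fun S => ?_
  have hm1 : Measurable fun t : (Fin d → Bool) × (Fin d → Bool) × (Fin L → Fin T → Hash d) =>
      G (S, t.1, t.2.1) t.2.2 := hm.comp measurable_prodMk_left
  rw [lintegral_prod _ hm1.aemeasurable, lintegral_prod _ (measurable_of_finite _).aemeasurable]
  refine lintegral_congr fun z => ?_
  have hm2 : Measurable fun t : (Fin d → Bool) × (Fin L → Fin T → Hash d) =>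
      G (S, z, t.1) t.2 := hm1.comp measurable_prodMk_left
  rw [lintegral_prod _ hm2.aemeasurable]

lemma map_inputLaw_triple (n : ℕ) (hp : ∀ i, 0 ≤ p i ∧ p i ≤ 1) (hα : 0 ≤ α ∧ α ≤ 1)
    (j : Fin n) :
    (inputLaw n p α).map (fun ω => (ω.1 j, ω.2.1, ω.2.2))
      = (vecLaw p).prod ((vecLaw p).prod (vecLaw fun _ : Fin d => α)) := by
  have := isProbabilityMeasure_vecLaw hp
  have := isProbabilityMeasure_vecLaw (d := d) (p := fun _ => α) fun _ => hα
  exact ((measurePreserving_eval (fun _ : Fin n => vecLaw p) j).prod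
    (MeasurePreserving.id ((vecLaw p).prod (vecLaw fun _ : Fin d => α)))).map_eq

lemma map_inputLaw_data (hp : ∀ i, 0 ≤ p i ∧ p i ≤ 1) (hα : 0 ≤ α ∧ α ≤ 1) (j : Fin n) :
    (inputLaw n p α).map (fun ω => ω.1 j) = vecLaw p := by
  have := isProbabilityMeasure_vecLaw hp
  have := isProbabilityMeasure_vecLaw (d := d) (p := fun _ => α) fun _ => hα
  exact ((measurePreserving_eval (fun _ : Fin n => vecLaw p) j).comp
    measurePreserving_fst).map_eq

lemma map_inputLaw_query (hp : ∀ i, 0 ≤ p i ∧ p i ≤ 1) (hα : 0 ≤ α ∧ α ≤ 1) (j : Fin n) :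
    (inputLaw n p α).map (fun ω => ω.query j) = vecLaw p := by
  rw [← map_vecLaw_correlate hp hα, ← map_inputLaw_triple n hp hα j,
    Measure.map_map (measurable_of_finite _) (measurable_of_finite _)]
  rfl

/-- Two different coordinates of a power of `μ` are independent with law `μ`. -/
lemma map_pi_pair {Ω : Type*} [MeasurableSpace Ω] (μ : Measure Ω) [IsProbabilityMeasure μ]
    {j k : Fin n} (hjk : k ≠ j) :
    (Measure.pi fun _ : Fin n => μ).map (fun S => (S k, S j)) = μ.prod μ := by
  have h := (iIndepFun_pi (μ := fun _ : Fin n => μ) (X := fun _ => (id : Ω → Ω))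
    fun _ => aemeasurable_id).indepFun hjk
  simp only [id] at h
  rw [indepFun_iff_map_prod_eq_prod_map_map (measurable_pi_apply k).aemeasurable
    (measurable_pi_apply j).aemeasurable] at h
  rw [h]
  congr 1
  · exact (measurePreserving_eval (fun _ : Fin n => μ) k).map_eq
  · exact (measurePreserving_eval (fun _ : Fin n => μ) j).map_eq

/-- The query is independent of every data vector that it is not derived from. -/
lemma map_inputLaw_data_query (hp : ∀ i, 0 ≤ p i ∧ p i ≤ 1) (hα : 0 ≤ α ∧ α ≤ 1) {j k : Fin n}
    (hjk : k ≠ j) :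
    (inputLaw n p α).map (fun ω => (ω.1 k, ω.query j)) = (vecLaw p).prod (vecLaw p) := by
  have := isProbabilityMeasure_vecLaw hp
  have := isProbabilityMeasure_vecLaw (d := d) (p := fun _ => α) fun _ => hα
  set ν := (vecLaw p).prod (vecLaw fun _ : Fin d => α) with hν
  have h1 : (inputLaw n p α).map (fun ω => ((ω.1 k, ω.1 j), ω.2))
      = ((vecLaw p).prod (vecLaw p)).prod ν := by
    rw [← map_pi_pair (vecLaw p) hjk]
    have := Measure.map_prod_map (Measure.pi fun _ : Fin n => vecLaw p) ν
      (f := fun S => (S k, S j)) (g := id) (by fun_prop) measurable_id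
    rw [Measure.map_id] at this
    rw [this]
    rfl
  have h2 : ((vecLaw p).prod (vecLaw p)).prod ν
      = ((vecLaw p).prod ((vecLaw p).prod ν)).map MeasurableEquiv.prodAssoc.symm := by
    rw [← (measurePreserving_prodAssoc (vecLaw p) (vecLaw p) ν).map_eq,
      Measure.map_map (MeasurableEquiv.measurable _) (MeasurableEquiv.measurable _)]
    simp
  have h3 := Measure.map_prod_map (vecLaw p) ((vecLaw p).prod ν) (f := id)
    (g := fun t => correlate t.1 t.2.1 t.2.2) measurable_id (measurable_of_finite _)
  rw [Measure.map_id, map_vecLaw_correlate hp hα] at h3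
  rw [h3]
  have h4 : (fun ω : Inputs n d => (ω.1 k, ω.query j))
      = (Prod.map id (fun t : (Fin d → Bool) × (Fin d → Bool) × (Fin d → Bool) =>
          correlate t.1 t.2.1 t.2.2) ∘ MeasurableEquiv.prodAssoc)
        ∘ fun ω => ((ω.1 k, ω.1 j), ω.2) := rfl
  rw [h4, ← Measure.map_map (measurable_of_finite _) (measurable_of_finite _), h1, h2,
    Measure.map_map (measurable_of_finite _) (MeasurableEquiv.measurable _)]
  rfl

/-- The common bits of a data vector and its correlated query. -/
lemma map_inputLaw_inter (hp : ∀ i, 0 ≤ p i ∧ p i ≤ 1) (hα : 0 ≤ α ∧ α ≤ 1) (j : Fin n) :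
    (inputLaw n p α).map (fun ω i => ω.1 j i && ω.query j i)
      = vecLaw fun i => p i * phat (p i) α := by
  have hor : ((vecLaw p).prod (vecLaw fun _ : Fin d => α)).map (fun t i => t.1 i || t.2 i)
      = vecLaw fun i => phat (p i) α := by
    rw [map_vecLaw_or hp fun _ => hα]
    congr 1
    ext i
    rw [phat]
    ring
  have hph : ∀ i, 0 ≤ phat (p i) α ∧ phat (p i) α ≤ 1 := fun i => by
    have := hp i
    unfold phat
    constructor <;> nlinarith
  rw [← map_vecLaw_and hp hph, ← hor]
  have h3 := Measure.map_prod_map (vecLaw p) ((vecLaw p).prod (vecLaw fun _ : Fin d => α))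
    (f := id) (g := fun t i => t.1 i || t.2 i) measurable_id (measurable_of_finite _)
  rw [Measure.map_id] at h3
  rw [h3, ← map_inputLaw_triple n hp hα j,
    Measure.map_map (measurable_of_finite _) (measurable_of_finite _),
    Measure.map_map (measurable_of_finite _) (measurable_of_finite _)]
  congr 1
  ext ω i
  simp only [Inputs.query, correlate, Function.comp_apply, Prod.map, id]
  cases ω.1 j i <;> cases ω.2.1 i <;> cases ω.2.2 i <;> rfl

/-- The common bits of the query and an unrelated data vector. -/
lemma map_inputLaw_inter_of_ne (hp : ∀ i, 0 ≤ p i ∧ p i ≤ 1) (hα : 0 ≤ α ∧ α ≤ 1) {j k : Fin n}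
    (hjk : k ≠ j) :
    (inputLaw n p α).map (fun ω i => ω.1 k i && ω.query j i) = vecLaw fun i => p i * p i := by
  rw [← map_vecLaw_and hp hp, ← map_inputLaw_data_query hp hα hjk,
    Measure.map_map (measurable_of_finite _) (measurable_of_finite _)]
  rfl

end SampleLaw

/-! ### Expected size of the exploration tree -/

section ExpectedCost

variable {n d : ℕ} {p : Fin d → ℝ} {α δ : ℝ}

lemma prod_map_nonneg (hp : ∀ i, 0 ≤ p i) (v : List (Fin d)) : 0 ≤ (v.map p).prod :=
  List.prod_nonneg (by simp only [List.mem_map]; rintro _ ⟨i, -, rfl⟩; exact hp i)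

open Classical in
/-- The expected tree sum over a random vector.  An incomplete path `v` has probability
`P > 1 / n`, so `1 ≤ (n * P) ^ ρ`; charging each node this factor makes the expected charge grow
only by the factor `β` per level. -/
lemma lintegral_expTreeSum_le {Ω : Type*} [MeasurableSpace Ω] [Finite Ω]
    [MeasurableSingletonClass Ω] {μ : Measure Ω} {q : Ω → Fin d → Bool}
    {b : Ω → List (Fin d) → ENNReal} {a₀ b₀ β D ρ : ℝ} {T₀ : ℕ}
    (hn : 0 < n) (hp : ∀ i, 0 ≤ p i) (hρ : 0 ≤ ρ) (ha₀ : 0 ≤ a₀) (hb₀ : 0 ≤ b₀) (hβ : 0 ≤ β)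
    (hq : ∀ v : List (Fin d), v.Nodup →
      ∫⁻ ω, (if Contains (q ω) v then 1 else 0) ∂μ ≤ ENNReal.ofReal (v.map p).prod)
    (hb : ∀ v : List (Fin d), v.Nodup → Complete n p v →
      ∫⁻ ω, (if Contains (q ω) v then b ω v else 0) ∂μ ≤ ENNReal.ofReal ((v.map p).prod * b₀))
    (ht : ∀ j < T₀, ∀ i, 0 ≤ threshold p α δ j i)
    (hsum : ∀ j < T₀, ∑ i, p i ^ (1 + ρ) * threshold p α δ j i ≤ β)
    (hD : a₀ ≤ D) (hD' : ∀ j < T₀, a₀ + b₀ * ∑ i, p i * threshold p α δ j i ≤ D)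
    (T : ℕ) (v : List (Fin d)) (hv : v.length + T = T₀) (hnd : v.Nodup)
    (hc : ¬ Complete n p v) :
    ∫⁻ ω, (if Contains (q ω) v then
        expTreeSum n p α δ (ENNReal.ofReal a₀) (b ω) (q ω) T v else 0) ∂μ
      ≤ ENNReal.ofReal ((v.map p).prod
          * (D * (n * (v.map p).prod) ^ ρ * ∑ s ∈ Finset.range (T + 1), β ^ s)) := by
  have hP0 : ∀ v : List (Fin d), 0 ≤ (v.map p).prod := prod_map_nonneg hp
  have hbig : ∀ v : List (Fin d), ¬ Complete n p v → 1 ≤ (n * (v.map p).prod) ^ ρ := by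
    intro v hv
    refine Real.one_le_rpow ?_ hρ
    rw [Complete, not_le, div_lt_iff₀ (by positivity)] at hv
    linarith
  have hD0 : 0 ≤ D := ha₀.trans hD
  have hS0 : ∀ T : ℕ, 0 ≤ ∑ s ∈ Finset.range (T + 1), β ^ s := fun T =>
    Finset.sum_nonneg fun s _ => pow_nonneg hβ s
  have hnode : ∀ v : List (Fin d), v.Nodup →
      ∫⁻ ω, (if Contains (q ω) v then ENNReal.ofReal a₀ else 0) ∂μ
        ≤ ENNReal.ofReal ((v.map p).prod * a₀) := by
    intro v hv
    have : ∀ ω, (if Contains (q ω) v then ENNReal.ofReal a₀ else 0)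
        = (if Contains (q ω) v then 1 else 0) * ENNReal.ofReal a₀ := fun ω => by
      split_ifs <;> simp
    simp_rw [this]
    rw [lintegral_mul_const _ (measurable_of_finite _), ENNReal.ofReal_mul (hP0 v)]
    exact mul_le_mul' (hq v hv) le_rfl
  induction T generalizing v with
  | zero =>
    simp only [expTreeSum, hc, if_false]
    refine (hnode v hnd).trans (ENNReal.ofReal_le_ofReal ?_)
    refine mul_le_mul_of_nonneg_left ?_ (hP0 v)
    simp only [zero_add, Finset.range_one, Finset.sum_singleton, pow_zero, mul_one]
    nlinarith [hbig v hc]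
  | succ T ih =>
    set P := (v.map p).prod with hP
    have hjT : v.length < T₀ := by omega
    -- the contribution of a single extension
    have hchild : ∀ i, i ∉ v → ∫⁻ ω, (if Contains (q ω) (i :: v) then
        expTreeSum n p α δ (ENNReal.ofReal a₀) (b ω) (q ω) T (i :: v) else 0) ∂μ
        ≤ ENNReal.ofReal (P * (p i * b₀ + p i ^ (1 + ρ)
          * (D * (n * P) ^ ρ * ∑ s ∈ Finset.range (T + 1), β ^ s))) := by
      intro i hi
      have hnd' : (i :: v).Nodup := List.nodup_cons.2 ⟨hi, hnd⟩
      have hPi : ((i :: v).map p).prod = p i * P := by simp [hP]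
      have hnn : 0 ≤ D * (n * P) ^ ρ * ∑ s ∈ Finset.range (T + 1), β ^ s :=
        mul_nonneg (mul_nonneg hD0 (Real.rpow_nonneg (mul_nonneg n.cast_nonneg (hP0 v)) _)) (hS0 T)
      by_cases hci : Complete n p (i :: v)
      · have : ∀ ω, expTreeSum n p α δ (ENNReal.ofReal a₀) (b ω) (q ω) T (i :: v)
            = b ω (i :: v) := fun ω => by cases T <;> simp [expTreeSum, hci]
        simp_rw [this]
        refine (hb _ hnd' hci).trans (ENNReal.ofReal_le_ofReal ?_)
        rw [hPi]
        have := mul_nonneg (hP0 v) (mul_nonneg (Real.rpow_nonneg (hp i) (1 + ρ)) hnn)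
        rw [← hP] at this
        nlinarith
      · refine (ih (i :: v) (by simp only [List.length_cons]; omega) hnd' hci).trans
          (ENNReal.ofReal_le_ofReal ?_)
        rw [hPi]
        have h1 : (n * (p i * P)) ^ ρ = p i ^ ρ * (n * P) ^ ρ := by
          rw [← Real.mul_rpow (hp i) (mul_nonneg n.cast_nonneg (hP0 v))]
          congr 1
          ring
        have h2 : p i ^ (1 + ρ) = p i * p i ^ ρ := by
          rcases (hp i).eq_or_lt with h0 | h0
          · rw [← h0, zero_mul, Real.zero_rpow (by linarith)]
          · rw [Real.rpow_add h0, Real.rpow_one]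
        rw [h1, h2]
        have := mul_nonneg (hP0 v) (mul_nonneg (hp i) hb₀)
        rw [← hP] at this
        nlinarith
    have hexp : ∀ ω, (if Contains (q ω) v then
        expTreeSum n p α δ (ENNReal.ofReal a₀) (b ω) (q ω) (T + 1) v else 0)
        = (if Contains (q ω) v then ENNReal.ofReal a₀ else 0)
          + ∑ i, if i ∈ v then 0 else ENNReal.ofReal (threshold p α δ v.length i)
            * (if Contains (q ω) (i :: v) then
              expTreeSum n p α δ (ENNReal.ofReal a₀) (b ω) (q ω) T (i :: v) else 0) := by
      intro ω
      have hcons : ∀ i, Contains (q ω) (i :: v) ↔ q ω i = true ∧ Contains (q ω) v := by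
        intro i; simp [Contains]
      by_cases h : Contains (q ω) v
      · simp only [expTreeSum, hc, h, if_true, if_false]
        congr 1
        refine Finset.sum_congr rfl fun i _ => ?_
        by_cases hi : i ∈ v <;> by_cases hqi : q ω i = true <;> simp [hi, hqi, hcons, h]
      · simp [h, hcons]
    simp_rw [hexp]
    rw [lintegral_add_left (measurable_of_finite _),
      lintegral_finsetSum _ fun i _ => measurable_of_finite _]
    have hterm : ∀ i, ∫⁻ ω, (if i ∈ v then 0 else
        ENNReal.ofReal (threshold p α δ v.length i) * (if Contains (q ω) (i :: v) then
          expTreeSum n p α δ (ENNReal.ofReal a₀) (b ω) (q ω) T (i :: v) else 0)) ∂μ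
        ≤ ENNReal.ofReal (threshold p α δ v.length i * (P * (p i * b₀ + p i ^ (1 + ρ)
          * (D * (n * P) ^ ρ * ∑ s ∈ Finset.range (T + 1), β ^ s)))) := by
      intro i
      split_ifs with hi
      · simp
      · rw [lintegral_const_mul _ (measurable_of_finite _),
          ENNReal.ofReal_mul (ht _ hjT i)]
        exact mul_le_mul' le_rfl (hchild i hi)
    refine (add_le_add (hnode v hnd) (Finset.sum_le_sum fun i _ => hterm i)).trans ?_
    have hX : 0 ≤ D * (n * P) ^ ρ * ∑ s ∈ Finset.range (T + 1), β ^ s :=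
      mul_nonneg (mul_nonneg hD0 (Real.rpow_nonneg (mul_nonneg n.cast_nonneg (hP0 v)) _)) (hS0 T)
    set X := D * (n * P) ^ ρ * ∑ s ∈ Finset.range (T + 1), β ^ s with hXdef
    rw [← ENNReal.ofReal_sum_of_nonneg, ← ENNReal.ofReal_add]
    · refine ENNReal.ofReal_le_ofReal ?_
      have h1 : ∑ i, threshold p α δ v.length i * (P * (p i * b₀ + p i ^ (1 + ρ) * X))
          = P * (b₀ * (∑ i, p i * threshold p α δ v.length i)
            + (∑ i, p i ^ (1 + ρ) * threshold p α δ v.length i) * X) := by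
        rw [Finset.mul_sum, Finset.sum_mul, ← Finset.sum_add_distrib, Finset.mul_sum]
        exact Finset.sum_congr rfl fun i _ => by ring
      have h2 : D * (n * P) ^ ρ * ∑ s ∈ Finset.range (T + 1 + 1), β ^ s
          = D * (n * P) ^ ρ + β * X := by
        rw [Finset.sum_range_succ', hXdef, pow_zero]
        simp_rw [pow_succ]
        rw [← Finset.sum_mul]
        ring
      rw [h1, h2, ← mul_add]
      refine mul_le_mul_of_nonneg_left ?_ (hP0 v)
      have h3 := hD' _ hjT
      have h4 := mul_le_mul_of_nonneg_right (hsum _ hjT) hX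
      have h5 := mul_le_mul_of_nonneg_left (hbig v hc) hD0
      rw [← hP] at h5
      linarith
    · exact mul_nonneg (hP0 v) ha₀
    · exact Finset.sum_nonneg fun i _ => mul_nonneg (ht _ hjT i) (mul_nonneg (hP0 v)
        (add_nonneg (mul_nonneg (hp i) hb₀) (mul_nonneg (Real.rpow_nonneg (hp i) _) hX)))
    · exact fun i _ => mul_nonneg (ht _ hjT i) (mul_nonneg (hP0 v)
        (add_nonneg (mul_nonneg (hp i) hb₀) (mul_nonneg (Real.rpow_nonneg (hp i) _) hX)))

end ExpectedCost

/-! ### Expected cost and space -/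

section ExpectedTotals

variable {n d L T : ℕ} {p : Fin d → ℝ} {α δ β γ ρ : ℝ} {𝓗 : Measure (Hash d)}

lemma measurable_treeSum_eval {a : ENNReal} {b : List (Fin d) → ENNReal} {x : Fin d → Bool}
    (r : Fin L) (v : List (Fin d)) :
    Measurable fun h : Fin L → Fin T → Hash d => treeSum n p α δ a b x (List.ofFn (h r)) v :=
  (measurable_treeSum T v).comp (measurable_pi_apply r)

lemma lintegral_sum_treeSum_le (h𝓗 : IsPairwiseIndepHash 𝓗) {a : ENNReal}
    {b : List (Fin d) → ENNReal} {x : Fin d → Bool} :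
    ∫⁻ h : Fin L → Fin T → Hash d, ∑ r, treeSum n p α δ a b x (List.ofFn (h r)) []
        ∂(Measure.pi fun _ => Measure.pi fun _ => 𝓗)
      ≤ L * expTreeSum n p α δ a b x T [] := by
  have := h𝓗.isProbabilityMeasure
  have hm := measurable_treeSum (n := n) (p := p) (α := α) (δ := δ) (a := a) (b := b) (x := x) T []
  rw [lintegral_finsetSum _ fun r _ => measurable_treeSum_eval r []]
  calc _ ≤ ∑ _r : Fin L, expTreeSum n p α δ a b x T [] := by
        refine Finset.sum_le_sum fun r _ => ?_
        refine le_trans (le_of_eq ?_) (lintegral_treeSum_le h𝓗 T [])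
        exact (measurePreserving_eval
          (fun _ : Fin L => Measure.pi fun _ : Fin T => 𝓗) r).lintegral_comp hm
    _ = _ := by simp

open Classical in
lemma lintegral_contains_le {Ω : Type*} [MeasurableSpace Ω] [Finite Ω]
    [MeasurableSingletonClass Ω] {μ : Measure Ω} {q : Ω → Fin d → Bool}
    (hp : ∀ i, 0 ≤ p i ∧ p i ≤ 1) (hq : μ.map q = vecLaw p) {v : List (Fin d)} (hv : v.Nodup) :
    ∫⁻ ω, (if Contains (q ω) v then 1 else 0) ∂μ ≤ ENNReal.ofReal (v.map p).prod := by
  rw [← vecLaw_forall_mem hp hv, ← hq, Measure.map_apply (measurable_of_finite _)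
    (Set.toFinite _).measurableSet, ← lintegral_indicator_one (Set.toFinite _).measurableSet]
  refine lintegral_mono fun ω => ?_
  rw [Set.indicator_apply]
  rfl

open Classical in
lemma lintegral_contains_pair_le {Ω : Type*} [MeasurableSpace Ω] [Finite Ω]
    [MeasurableSingletonClass Ω] {μ : Measure Ω} {x q : Ω → Fin d → Bool}
    (hp : ∀ i, 0 ≤ p i ∧ p i ≤ 1)
    (hq : μ.map (fun ω => (x ω, q ω)) = (vecLaw p).prod (vecLaw p))
    {v : List (Fin d)} (hv : v.Nodup) :
    ∫⁻ ω, (if Contains (q ω) v then if Contains (x ω) v then 1 else 0 else 0) ∂μ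
      ≤ ENNReal.ofReal (v.map p).prod * ENNReal.ofReal (v.map p).prod := by
  rw [← vecLaw_forall_mem hp hv, ← Measure.prod_prod, ← hq,
    Measure.map_apply (measurable_of_finite _) (Set.toFinite _).measurableSet,
    ← lintegral_indicator_one (Set.toFinite _).measurableSet]
  refine lintegral_mono fun ω => ?_
  rw [Set.indicator_apply]
  by_cases h1 : Contains (q ω) v <;> by_cases h2 : Contains (x ω) v
  · rw [if_pos h1, if_pos h2]
    refine le_of_eq (Eq.symm (if_pos ?_))
    exact ⟨h2, h1⟩
  all_goals simp [h1, h2]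

lemma not_complete_nil (hn : 2 ≤ n) : ¬ Complete n p [] := by
  have : (2 : ℝ) ≤ n := by exact_mod_cast hn
  rw [Complete, not_le, List.map_nil, List.prod_nil, div_lt_one (by linarith)]
  linarith

open Classical in
/-- The expected cost of a query.  In the bucket of a filter `f` of the query, the expected number
of vectors other than the `j`-th one is at most `n` times the probability that a random vector
contains `f`, hence at most one. -/
lemma lintegral_steps_le (hn : 2 ≤ n) (hp : ∀ i, 0 ≤ p i ∧ p i ≤ 1) (hα : 0 ≤ α ∧ α ≤ 1)
    (h𝓗 : IsPairwiseIndepHash 𝓗) (hρ : 0 ≤ ρ) (hβ : 0 ≤ β) (hγ : 0 ≤ γ)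
    (ht : ∀ j < T, ∀ i, 0 ≤ threshold p α δ j i)
    (hsum : ∀ j < T, ∑ i, p i ^ (1 + ρ) * threshold p α δ j i ≤ β)
    (hmass : ∀ j < T, ∑ i, p i * threshold p α δ j i ≤ γ) (j : Fin n) :
    ∫⁻ t, ((answer p α δ j t).steps : ENNReal) ∂(sampleLaw n L T p α 𝓗)
      ≤ ENNReal.ofReal (L * (((T + 1 + d * (1 + 2 * (T + 1)))
          + (2 * (T + 1) + 2 * (d + 1)) * γ) * (n : ℝ) ^ ρ
          * ∑ s ∈ Finset.range (T + 1), β ^ s)) := by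
  have := h𝓗.isProbabilityMeasure
  have := isProbabilityMeasure_inputLaw n hp hα
  set a₀ : ℝ := T + 1 + d * (1 + 2 * (T + 1)) with ha₀
  set b₀ : ℝ := 2 * (T + 1) + 2 * (d + 1) with hb₀
  have ha₀0 : 0 ≤ a₀ := by positivity
  have hb₀0 : 0 ≤ b₀ := by positivity
  set b : Inputs n d → List (Fin d) → ENNReal := fun ω f => ((2 * (T + 1) + (d + 1)
      * (1 + ∑ y ∈ Finset.univ.erase j, if Contains (ω.1 y) f then 1 else 0) : ℕ) : ENNReal)
    with hbdef
  have hpt : ∀ t : RawSample n d L T, ((answer p α δ j t).steps : ENNReal)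
      ≤ ∑ r, treeSum n p α δ (ENNReal.ofReal a₀) (b (t.1, t.2.1, t.2.2.1))
        (Inputs.query (t.1, t.2.1, t.2.2.1) j) (List.ofFn (t.2.2.2 r)) [] := by
    intro t
    refine steps_search_le t.1 t.2.2.2 _ j ?_ fun f => le_rfl
    rw [← ENNReal.ofReal_natCast]
    refine le_of_eq ?_
    congr 1
    push_cast
    rw [ha₀]
  refine (lintegral_mono hpt).trans ?_
  rw [lintegral_sampleLaw (G := fun ω h => ∑ r, treeSum n p α δ (ENNReal.ofReal a₀) (b ω)
    (Inputs.query ω j) (List.ofFn (h r)) []) fun ω => Finset.measurable_fun_sum _ fun r _ =>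
      measurable_treeSum_eval r []]
  refine (lintegral_mono fun ω => lintegral_sum_treeSum_le h𝓗).trans ?_
  rw [lintegral_const_mul _ (measurable_of_finite _), ENNReal.ofReal_mul L.cast_nonneg,
    ENNReal.ofReal_natCast]
  refine mul_le_mul' le_rfl ?_
  have hleaf : ∀ v : List (Fin d), v.Nodup → Complete n p v →
      ∫⁻ ω, (if Contains (Inputs.query ω j) v then b ω v else 0) ∂(inputLaw n p α)
        ≤ ENNReal.ofReal ((v.map p).prod * b₀) := by
    intro v hv hc
    have hP0 := prod_map_nonneg (fun i => (hp i).1) v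
    set P := (v.map p).prod with hP
    have hsplit : ∀ ω : Inputs n d, (if Contains (Inputs.query ω j) v then b ω v else 0)
        = ((2 * (T + 1) + (d + 1) : ℕ) : ENNReal)
            * (if Contains (Inputs.query ω j) v then 1 else 0)
          + ((d + 1 : ℕ) : ENNReal) * ∑ y ∈ Finset.univ.erase j,
            (if Contains (Inputs.query ω j) v then if Contains (ω.1 y) v then 1 else 0
              else 0) := by
      intro ω
      by_cases h : Contains (Inputs.query ω j) v
      · simp only [h, if_true, hbdef]
        push_cast
        ring
      · simp [h]
    simp_rw [hsplit]
    rw [lintegral_add_left (measurable_of_finite _), lintegral_const_mul _ (measurable_of_finite _),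
      lintegral_const_mul _ (measurable_of_finite _),
      lintegral_finsetSum _ fun y _ => measurable_of_finite _]
    have h1 := lintegral_contains_le hp (map_inputLaw_query (n := n) hp hα j) hv
    have h2 : ∑ y ∈ Finset.univ.erase j, ∫⁻ ω : Inputs n d, (if Contains (Inputs.query ω j) v then
        if Contains (ω.1 y) v then 1 else 0 else 0) ∂(inputLaw n p α)
        ≤ ENNReal.ofReal P := by
      calc _ ≤ ∑ y ∈ Finset.univ.erase j, ENNReal.ofReal P * ENNReal.ofReal P :=
            Finset.sum_le_sum fun y hy => lintegral_contains_pair_le hp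
              (map_inputLaw_data_query hp hα (Finset.ne_of_mem_erase hy)) hv
        _ ≤ ∑ _y : Fin n, ENNReal.ofReal P * ENNReal.ofReal P :=
            Finset.sum_le_sum_of_subset (Finset.erase_subset _ _)
        _ = ENNReal.ofReal (n * (P * P)) := by
            rw [Finset.sum_const, Finset.card_univ, Fintype.card_fin, nsmul_eq_mul,
              ENNReal.ofReal_mul n.cast_nonneg, ENNReal.ofReal_mul hP0, ENNReal.ofReal_natCast]
        _ ≤ ENNReal.ofReal P := by
            refine ENNReal.ofReal_le_ofReal ?_
            have hnP : n * P ≤ 1 := by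
              have hn0 : (0 : ℝ) < n := by positivity
              have : P ≤ 1 / n := hc
              rw [le_div_iff₀ hn0] at this
              linarith
            nlinarith
    refine (add_le_add (mul_le_mul' le_rfl h1) (mul_le_mul' le_rfl h2)).trans (le_of_eq ?_)
    rw [← ENNReal.ofReal_natCast, ← ENNReal.ofReal_natCast, ← ENNReal.ofReal_mul (by positivity),
      ← ENNReal.ofReal_mul (by positivity), ← ENNReal.ofReal_add (by positivity) (by positivity)]
    congr 1
    rw [hb₀]
    push_cast
    ring
  have key := lintegral_expTreeSum_le (μ := inputLaw n p α) (q := fun ω => Inputs.query ω j)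
    (b := b) (D := a₀ + b₀ * γ) (by omega) (fun i => (hp i).1) hρ ha₀0 hb₀0 hβ
    (fun v hv => lintegral_contains_le hp (map_inputLaw_query hp hα j) hv) hleaf ht hsum
    (by nlinarith) (fun k hk => by nlinarith [hmass k hk, mul_le_mul_of_nonneg_left (hmass k hk) hb₀0])
    T [] (by simp) List.nodup_nil (not_complete_nil hn)
  simpa [Contains] using key

open Classical in
/-- The expected space of the data structure. -/
lemma lintegral_space_le (hn : 2 ≤ n) (hp : ∀ i, 0 ≤ p i ∧ p i ≤ 1) (hα : 0 ≤ α ∧ α ≤ 1)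
    (h𝓗 : IsPairwiseIndepHash 𝓗) (hρ : 0 ≤ ρ) (hβ : 0 ≤ β) (hγ : 0 ≤ γ)
    (ht : ∀ j < T, ∀ i, 0 ≤ threshold p α δ j i)
    (hsum : ∀ j < T, ∑ i, p i ^ (1 + ρ) * threshold p α δ j i ≤ β)
    (hmass : ∀ j < T, ∑ i, p i * threshold p α δ j i ≤ γ) :
    ∫⁻ t, ((built p α δ t).space : ENNReal) ∂(sampleLaw n L T p α 𝓗)
      ≤ ENNReal.ofReal ((n * d + d + 2 * (L * T)) + n * (L * ((T + 2) * γ * (n : ℝ) ^ ρ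
          * ∑ s ∈ Finset.range (T + 1), β ^ s))) := by
  have := h𝓗.isProbabilityMeasure
  have := isProbabilityMeasure_inputLaw n hp hα
  set E : ℝ := (T + 2) * γ * (n : ℝ) ^ ρ * ∑ s ∈ Finset.range (T + 1), β ^ s with hE
  have hE0 : 0 ≤ E := by
    have : 0 ≤ ∑ s ∈ Finset.range (T + 1), β ^ s := Finset.sum_nonneg fun s _ => pow_nonneg hβ s
    positivity
  have hpt : ∀ t : RawSample n d L T, ((built p α δ t).space : ENNReal)
      ≤ ((n * d + d + 2 * (L * T) : ℕ) : ENNReal) + ∑ y, ∑ r, treeSum n p α δ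
        (ENNReal.ofReal 0) (fun _ => ((T + 2 : ℕ) : ENNReal)) (t.1 y) (List.ofFn (t.2.2.2 r)) [] := by
    intro t
    rw [ENNReal.ofReal_zero, Finset.sum_comm]
    exact space_build_le t.1 t.2.2.2
  have hm : ∀ ω : Inputs n d, Measurable fun h : Fin L → Fin T → Hash d =>
      ∑ y, ∑ r, treeSum n p α δ (ENNReal.ofReal 0)
        (fun _ => ((T + 2 : ℕ) : ENNReal)) (ω.1 y) (List.ofFn (h r)) [] := fun ω =>
    Finset.measurable_fun_sum _ fun y _ => Finset.measurable_fun_sum _ fun r _ =>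
      measurable_treeSum_eval r []
  refine (lintegral_mono hpt).trans ?_
  rw [lintegral_sampleLaw (G := fun ω h => ((n * d + d + 2 * (L * T) : ℕ) : ENNReal)
      + ∑ y, ∑ r, treeSum n p α δ (ENNReal.ofReal 0)
        (fun _ => ((T + 2 : ℕ) : ENNReal)) (ω.1 y) (List.ofFn (h r)) [])
      fun ω => measurable_const.add (hm ω)]
  have hω : ∀ ω : Inputs n d, ∫⁻ h : Fin L → Fin T → Hash d,
      (((n * d + d + 2 * (L * T) : ℕ) : ENNReal) + ∑ y, ∑ r, treeSum n p α δ (ENNReal.ofReal 0)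
        (fun _ => ((T + 2 : ℕ) : ENNReal)) (ω.1 y) (List.ofFn (h r)) [])
        ∂(Measure.pi fun _ => Measure.pi fun _ => 𝓗)
      ≤ ((n * d + d + 2 * (L * T) : ℕ) : ENNReal) + ∑ y, L * expTreeSum n p α δ (ENNReal.ofReal 0)
        (fun _ => ((T + 2 : ℕ) : ENNReal)) (ω.1 y) T [] := by
    intro ω
    rw [lintegral_add_left measurable_const, lintegral_const, measure_univ, mul_one,
      lintegral_finsetSum _ fun y _ => Finset.measurable_fun_sum _ fun r _ =>
        measurable_treeSum_eval r []]
    gcongr with y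
    exact lintegral_sum_treeSum_le h𝓗
  refine (lintegral_mono hω).trans ?_
  rw [lintegral_add_left measurable_const, lintegral_const, measure_univ, mul_one,
    lintegral_finsetSum _ fun y _ => measurable_of_finite _]
  have hy : ∀ y : Fin n, ∫⁻ ω : Inputs n d, L * expTreeSum n p α δ (ENNReal.ofReal 0)
        (fun _ => ((T + 2 : ℕ) : ENNReal)) (ω.1 y) T [] ∂(inputLaw n p α)
      ≤ ENNReal.ofReal (L * E) := by
    intro y
    rw [lintegral_const_mul _ (measurable_of_finite _), ENNReal.ofReal_mul L.cast_nonneg,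
      ENNReal.ofReal_natCast]
    refine mul_le_mul' le_rfl ?_
    have hb : ∀ v : List (Fin d), v.Nodup → Complete n p v →
        ∫⁻ ω : Inputs n d, (if Contains (ω.1 y) v then ((T + 2 : ℕ) : ENNReal) else 0)
          ∂(inputLaw n p α) ≤ ENNReal.ofReal ((v.map p).prod * (T + 2)) := by
      intro v hv _
      have : ∀ ω : Inputs n d, (if Contains (ω.1 y) v then ((T + 2 : ℕ) : ENNReal) else 0)
          = (if Contains (ω.1 y) v then 1 else 0) * ((T + 2 : ℕ) : ENNReal) := fun ω => by
        split_ifs <;> simp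
      simp_rw [this]
      rw [lintegral_mul_const _ (measurable_of_finite _),
        ENNReal.ofReal_mul (prod_map_nonneg (fun i => (hp i).1) v)]
      refine mul_le_mul' (lintegral_contains_le hp (map_inputLaw_data hp hα y) hv) (le_of_eq ?_)
      rw [← ENNReal.ofReal_natCast]
      push_cast
      rfl
    have key := lintegral_expTreeSum_le (μ := inputLaw n p α) (q := fun ω => ω.1 y)
      (b := fun _ _ => ((T + 2 : ℕ) : ENNReal)) (a₀ := 0) (b₀ := T + 2) (D := (T + 2) * γ)
      (by omega) (fun i => (hp i).1) hρ le_rfl (by positivity) hβ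
      (fun v hv => lintegral_contains_le hp (map_inputLaw_data hp hα y) hv) hb ht hsum
      (by positivity) (fun k hk => by
        have : (0 : ℝ) ≤ T + 2 := by positivity
        linarith [mul_le_mul_of_nonneg_left (hmass k hk) this])
      T [] (by simp) List.nodup_nil (not_complete_nil hn)
    simpa [Contains, hE] using key
  refine (add_le_add le_rfl (Finset.sum_le_sum fun y _ => hy y)).trans (le_of_eq ?_)
  rw [Finset.sum_const, Finset.card_univ, Fintype.card_fin, nsmul_eq_mul,
    ENNReal.ofReal_add (by positivity) (by positivity), ENNReal.ofReal_mul n.cast_nonneg,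
    ENNReal.ofReal_natCast, ← ENNReal.ofReal_natCast]
  push_cast
  rfl

end ExpectedTotals

/-! ### The thresholds -/

section Threshold

variable {d : ℕ} {p : Fin d → ℝ} {α δ : ℝ}

lemma le_phat {x : ℝ} (hx : 0 ≤ x) (hα1 : α ≤ 1) : α ≤ phat x α := by
  unfold phat; nlinarith

lemma phat_le_one {x : ℝ} (hx : x ≤ 1) (hα1 : α ≤ 1) : phat x α ≤ 1 := by
  unfold phat; nlinarith

/-- If the length `j` of the path is small compared with `∑ p`, then the threshold agrees with
`1 / (phat (p i) α * ∑ p)` up to two factors `1 + δ`. -/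
lemma threshold_bounds (hp : ∀ i, 0 ≤ p i) (hα : 0 < α) (hα1 : α ≤ 1) (hδ : 0 < δ) (hδ1 : δ ≤ 1)
    (hm : 0 < ∑ k, p k) {j : ℕ} (hj : (j : ℝ) ≤ δ / 4 * (α * ∑ k, p k)) (i : Fin d) :
    (1 + δ) / (phat (p i) α * ∑ k, p k) ≤ threshold p α δ j i ∧
      threshold p α δ j i ≤ (1 + δ) ^ 2 / (phat (p i) α * ∑ k, p k) := by
  have hph := le_phat (hp i) hα1
  have hle : α * ∑ k, p k ≤ phat (p i) α * ∑ k, p k := mul_le_mul_of_nonneg_right hph hm.le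
  have hpos : 0 < α * ∑ k, p k := mul_pos hα hm
  set y := phat (p i) α * ∑ k, p k with hy
  have hj2 : (j : ℝ) ≤ δ / 4 * y := hj.trans (mul_le_mul_of_nonneg_left hle (by linarith))
  have hy0 : 0 < y := hpos.trans_le hle
  have hj0 : (0 : ℝ) ≤ j := j.cast_nonneg
  have hden : 0 < y - j := by nlinarith
  unfold threshold
  rw [← hy]
  constructor
  · exact div_le_div_of_nonneg_left (by linarith) hden (by linarith)
  · rw [div_le_div_iff₀ hden hy0]
    have h1 : y ≤ (1 + δ) * (y - j) := by
      have h2 : (1 + δ) * j ≤ (1 + δ) * (δ / 4 * y) :=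
        mul_le_mul_of_nonneg_left hj2 (by linarith)
      have h3 : 0 ≤ δ * y * (3 - δ) := mul_nonneg (mul_nonneg hδ.le hy0.le) (by linarith)
      nlinarith
    nlinarith

end Threshold

/-! ### Probability of success -/

section Success

variable {n d L T : ℕ} {p : Fin d → ℝ} {α δ : ℝ} {𝓗 : Measure (Hash d)}

/-- An event that forces the inputs into `B` or the hash functions into a set `N ω` has probability
at most that of `B` plus the largest probability of `N ω` for inputs `ω` outside `B`.  The event
itself need not be measurable. -/
lemma sampleLaw_le (h𝓗 : IsPairwiseIndepHash 𝓗) (hp : ∀ i, 0 ≤ p i ∧ p i ≤ 1)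
    (hα : 0 ≤ α ∧ α ≤ 1) {s : Set (RawSample n d L T)} {B : Set (Inputs n d)}
    {N : Inputs n d → Set (Fin L → Fin T → Hash d)} (hN : ∀ ω, MeasurableSet (N ω))
    (hs : ∀ t ∈ s, (t.1, t.2.1, t.2.2.1) ∈ B ∨ t.2.2.2 ∈ N (t.1, t.2.1, t.2.2.1)) {e : ENNReal}
    (he : ∀ ω, ω ∉ B → (Measure.pi fun _ => Measure.pi fun _ => 𝓗) (N ω) ≤ e) :
    sampleLaw n L T p α 𝓗 s ≤ inputLaw n p α B + e := by
  have := h𝓗.isProbabilityMeasure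
  have := isProbabilityMeasure_inputLaw n hp hα
  have hB : MeasurableSet B := (Set.toFinite _).measurableSet
  set G : Inputs n d → (Fin L → Fin T → Hash d) → ENNReal := fun ω h =>
    B.indicator 1 ω + Bᶜ.indicator 1 ω * (N ω).indicator 1 h with hG
  have hGm : ∀ ω, Measurable (G ω) := fun ω =>
    measurable_const.add (measurable_const.mul (measurable_one.indicator (hN ω)))
  have hsub : s ⊆ {t | 1 ≤ G (t.1, t.2.1, t.2.2.1) t.2.2.2} := by
    intro t ht
    change 1 ≤ G (t.1, t.2.1, t.2.2.1) t.2.2.2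
    rw [hG]
    by_cases hb : (t.1, t.2.1, t.2.2.1) ∈ B
    · simp [hb]
    · have := (hs t ht).resolve_left hb
      simp [hb, this]
  have hmk := mul_meas_ge_le_lintegral (μ := sampleLaw n L T p α 𝓗) (measurable_sample hGm) 1
  rw [one_mul] at hmk
  refine (measure_mono hsub).trans (hmk.trans ?_)
  rw [lintegral_sampleLaw hGm]
  have hω : ∀ ω, ∫⁻ h, G ω h ∂(Measure.pi fun _ => Measure.pi fun _ => 𝓗)
      ≤ B.indicator 1 ω + e := by
    intro ω
    rw [hG]
    simp only
    rw [lintegral_add_left measurable_const, lintegral_const, measure_univ, mul_one,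
      lintegral_const_mul _ (measurable_one.indicator (hN ω)), lintegral_indicator_one (hN ω)]
    gcongr
    by_cases hb : ω ∈ B
    · simp [hb]
    · simpa [hb] using he ω hb
  refine (lintegral_mono hω).trans ?_
  rw [lintegral_add_left (measurable_one.indicator hB), lintegral_indicator_one hB,
    lintegral_const, measure_univ, mul_one]

/-- The thresholds that distribute the mass of one extension over the coordinates of `A` that are
not on the path, in proportion to `1 / phat (p i) α`. -/
noncomputable def criticalThreshold {d : ℕ} (p : Fin d → ℝ) (α : ℝ) (A : Fin d → Bool)
    (v : List (Fin d)) (i : Fin d) : ℝ :=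
  (if A i = true ∧ i ∉ v then 1 / phat (p i) α else 0)
    / ∑ k, if A k = true ∧ k ∉ v then 1 / phat (p k) α else 0

/-- If `∑_{i ∈ A} 1 / phat (p i) α` is large enough, then the total mass of the extensions of every
short path can be reduced to one without exceeding the true thresholds. -/
lemma criticalThreshold_spec (hp : ∀ i, 0 ≤ p i) (hα : 0 < α) (hα1 : α ≤ 1) (hδ : 0 < δ)
    (hδ1 : δ ≤ 1) (hm : 0 < ∑ k, p k)
    (hT : ∀ j < T, (j : ℝ) ≤ δ / 4 * (α * ∑ k, p k)) {A : Fin d → Bool}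
    (hA : (∑ k, p k) / (1 + δ) + T / α
      ≤ ∑ i, if A i = true then 1 / phat (p i) α else 0) :
    IsCritical A (criticalThreshold p α A) T ∧
      ∀ v i, v.length < T → A i = true → i ∉ v →
        criticalThreshold p α A v i ≤ threshold p α δ v.length i := by
  have hph : ∀ i, 0 < phat (p i) α := fun i => hα.trans_le (le_phat (hp i) hα1)
  have hnn : ∀ (v : List (Fin d)) i, 0 ≤ if A i = true ∧ i ∉ v then 1 / phat (p i) α else 0 := by
    intro v i
    split_ifs
    · exact (one_div_pos.2 (hph i)).le
    · exact le_rfl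
  have hmass : ∀ v : List (Fin d), v.length < T → (∑ k, p k) / (1 + δ)
      ≤ ∑ k, if A k = true ∧ k ∉ v then 1 / phat (p k) α else 0 := by
    intro v hv
    have h1 : ∑ i, (if A i = true then 1 / phat (p i) α else 0)
        ≤ ∑ i, ((if A i = true ∧ i ∉ v then 1 / phat (p i) α else 0)
          + if i ∈ v.toFinset then 1 / α else 0) := by
      refine Finset.sum_le_sum fun i _ => ?_
      have h2 : 1 / phat (p i) α ≤ 1 / α := one_div_le_one_div_of_le hα (le_phat (hp i) hα1)
      have h3 : 0 < 1 / α := one_div_pos.2 hα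
      by_cases hi : i ∈ v <;> by_cases hAi : A i = true <;> simp [hi, hAi] <;>
        simp only [one_div] at h2 h3 <;> linarith
    rw [Finset.sum_add_distrib, Finset.sum_ite_mem, Finset.univ_inter, Finset.sum_const,
      nsmul_eq_mul] at h1
    have h4 : (v.toFinset.card : ℝ) * (1 / α) ≤ T / α := by
      rw [mul_one_div]
      refine div_le_div_of_nonneg_right ?_ hα.le
      exact_mod_cast (List.toFinset_card_le v).trans hv.le
    linarith
  have hM : 0 < (∑ k, p k) / (1 + δ) := div_pos hm (by linarith)
  refine ⟨⟨fun v i hv => ?_, fun v i _ hi => ?_, fun v hv => ?_⟩, fun v i hv hAi hiv => ?_⟩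
  · exact div_nonneg (hnn v i) (hM.le.trans (hmass v hv))
  · simp [criticalThreshold, hi]
  · unfold criticalThreshold
    rw [← Finset.sum_div]
    exact div_self (hM.trans_le (hmass v hv)).ne'
  · refine le_trans ?_ (threshold_bounds hp hα hα1 hδ hδ1 hm (hT _ hv) i).1
    unfold criticalThreshold
    rw [if_pos ⟨hAi, hiv⟩]
    refine (div_le_div_of_nonneg_left (one_div_pos.2 (hph i)).le hM (hmass v hv)).trans
      (le_of_eq ?_)
    have := (hph i).ne'
    have : 1 + δ ≠ 0 := by linarith
    field_simp

lemma cast_weight (y : Fin d → Bool) :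
    (weight y : ℝ) = ∑ i, if y i = true then (1 : ℝ) else 0 := by
  simp [weight]

/-- The correlation raises the expected size of `x ∩ q` above that of `y ∩ q` by at least
`α / 2 * ∑ p`, that is by `8 * η * ∑ p`, while each of the sizes deviates from its expectation by at
most `η * ∑ p`. -/
lemma similarity_lt {x y q : Fin d → Bool} {η : ℝ} (hp : ∀ i, 0 ≤ p i ∧ p i < 1 / 2)
    (hα : 0 < α) (hα1 : α ≤ 1) (hη : η = α / 16) (hm : 0 < ∑ k, p k)
    (hxq : ∑ i, p i * phat (p i) α - η * ∑ k, p k < weight fun i => x i && q i)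
    (hx : (weight x : ℝ) < ∑ k, p k + η * ∑ k, p k)
    (hq : (weight q : ℝ) < ∑ k, p k + η * ∑ k, p k)
    (hq' : ∑ k, p k - η * ∑ k, p k < weight q)
    (hyq : (weight fun i => y i && q i : ℝ) < ∑ i, p i * p i + η * ∑ k, p k) :
    similarity y q < similarity x q := by
  have h1 : ∑ i, p i * p i + α / 2 * ∑ k, p k ≤ ∑ i, p i * phat (p i) α := by
    rw [Finset.mul_sum, ← Finset.sum_add_distrib]
    refine Finset.sum_le_sum fun i _ => ?_
    have := hp i
    unfold phat
    nlinarith [mul_nonneg (mul_nonneg hα.le this.1) (show 0 ≤ 1 / 2 - p i by linarith)]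
  have h2 : ∑ i, p i * p i ≤ 1 / 2 * ∑ k, p k := by
    rw [Finset.mul_sum]
    exact Finset.sum_le_sum fun i _ => by nlinarith [hp i]
  have h3 : 0 ≤ ∑ i, p i * p i := Finset.sum_nonneg fun i _ => mul_self_nonneg _
  set m := ∑ k, p k
  set P := ∑ i, p i * p i
  have hη0 : 0 < η := by rw [hη]; linarith
  have hη1 : η ≤ 1 / 16 := by rw [hη]; linarith
  have hbx : ((max (weight x) (weight q) : ℕ) : ℝ) < (1 + η) * m := by
    push_cast
    rw [max_lt_iff]
    constructor <;> linarith
  have hby : (1 - η) * m < ((max (weight y) (weight q) : ℕ) : ℝ) := by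
    push_cast
    exact lt_max_of_lt_right (by linarith)
  have hbx0 : (0 : ℝ) < ((max (weight x) (weight q) : ℕ) : ℝ) := by
    push_cast
    exact lt_max_of_lt_right (by nlinarith)
  have hby0 : (0 : ℝ) < ((max (weight y) (weight q) : ℕ) : ℝ) := lt_trans (by nlinarith) hby
  have hmain : (weight (fun i => y i && q i) : ℝ) * ((max (weight x) (weight q) : ℕ) : ℝ)
      < (weight (fun i => x i && q i) : ℝ) * ((max (weight y) (weight q) : ℕ) : ℝ) := by
    have hηm : 0 < η * m := mul_pos hη0 hm
    calc _ ≤ (P + η * m) * ((1 + η) * m) :=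
          mul_le_mul hyq.le hbx.le hbx0.le (by linarith)
      _ < (P + 7 * (η * m)) * ((1 - η) * m) := by
          have e : (P + 7 * (η * m)) * ((1 - η) * m) - (P + η * m) * ((1 + η) * m)
              = η * m * (6 * m - 8 * (η * m) - 2 * P) := by ring
          have : 0 < η * m * (6 * m - 8 * (η * m) - 2 * P) := by
            refine mul_pos hηm ?_
            nlinarith
          linarith
      _ ≤ _ := by
          refine mul_le_mul ?_ hby.le (by nlinarith) (Nat.cast_nonneg _)
          have : α / 2 * m = 8 * (η * m) := by rw [hη]; ring
          linarith
  unfold similarity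
  have hbx0' : (0 : ℚ) < ((max (weight x) (weight q) : ℕ) : ℚ) := by exact_mod_cast hbx0
  have hby0' : (0 : ℚ) < ((max (weight y) (weight q) : ℕ) : ℚ) := by exact_mod_cast hby0
  rw [div_lt_div_iff₀ hby0' hbx0']
  exact_mod_cast hmain

/-- The inputs on which the data structure may fail, apart from unlucky hash functions: the common
part of the query and its data vector carries too little weight, or one of the sizes that enter the
similarities deviates from its expectation. -/
def badInputs (n : ℕ) {d : ℕ} (p : Fin d → ℝ) (α δ η : ℝ) (j : Fin n) : Set (Inputs n d) :=
  {ω | ∑ i, (if (ω.1 j i && ω.query j i) = true then α / phat (p i) α else 0)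
      ≤ ∑ i, p i * phat (p i) α * (α / phat (p i) α) - δ / 4 * (α * ∑ k, p k)} ∪
  {ω | ∑ i, (if (ω.1 j i && ω.query j i) = true then 1 else 0)
      ≤ ∑ i, p i * phat (p i) α * 1 - η * ∑ k, p k} ∪
  {ω | ∑ k, p k + η * ∑ k, p k ≤ ∑ i, if ω.1 j i = true then 1 else 0} ∪
  {ω | ∑ k, p k + η * ∑ k, p k ≤ ∑ i, if ω.query j i = true then 1 else 0} ∪
  {ω | ∑ i, (if ω.query j i = true then 1 else 0) ≤ ∑ k, p k * 1 - η * ∑ k, p k} ∪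
  ⋃ k ∈ Finset.univ.erase j,
    {ω | ∑ i, p i * p i + η * ∑ k, p k ≤ ∑ i, if (ω.1 k i && ω.query j i) = true then 1 else 0}

lemma inputLaw_preimage {r : Fin d → ℝ} {Y : Inputs n d → Fin d → Bool}
    (hY : (inputLaw n p α).map Y = vecLaw r) (s : Set (Fin d → Bool)) :
    inputLaw n p α (Y ⁻¹' s) = vecLaw r s := by
  rw [← hY, Measure.map_apply (measurable_of_finite _) (Set.toFinite _).measurableSet]

lemma inputLaw_badInputs_le (hp : ∀ i, 0 ≤ p i ∧ p i < 1 / 2) (hα : 0 < α) (hα1 : α ≤ 1)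
    (hδ : 0 < δ) {η ν : ℝ} (hη0 : 0 ≤ η) (hη1 : η ≤ 1)
    (hν1 : ν ≤ δ ^ 2 * α / 32) (hν2 : ν ≤ η ^ 2 / 4) (j : Fin n) :
    inputLaw n p α (badInputs n p α δ η j)
      ≤ ENNReal.ofReal ((n + 5) * Real.exp (-(ν * ∑ k, p k))) := by
  have hp' : ∀ i, 0 ≤ p i ∧ p i ≤ 1 := fun i => ⟨(hp i).1, by linarith [(hp i).2]⟩
  have hα' : 0 ≤ α ∧ α ≤ 1 := ⟨hα.le, hα1⟩
  have hph : ∀ i, 0 < phat (p i) α := fun i => hα.trans_le (le_phat (hp i).1 hα1)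
  have hph1 : ∀ i, phat (p i) α ≤ 1 := fun i => phat_le_one (hp' i).2 hα1
  have hm : 0 ≤ ∑ k, p k := Finset.sum_nonneg fun k _ => (hp k).1
  have hr : ∀ i, 0 ≤ p i * phat (p i) α ∧ p i * phat (p i) α ≤ 1 := fun i =>
    ⟨mul_nonneg (hp i).1 (hph i).le, mul_le_one₀ (hp' i).2 (hph i).le (hph1 i)⟩
  have hr2 : ∀ i, 0 ≤ p i * p i ∧ p i * p i ≤ 1 := fun i =>
    ⟨mul_self_nonneg _, mul_le_one₀ (hp' i).2 (hp i).1 (hp' i).2⟩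
  set E := ENNReal.ofReal (Real.exp (-(ν * ∑ k, p k))) with hE
  have hexp : ∀ u : ℝ, ν * ∑ k, p k ≤ u → ENNReal.ofReal (Real.exp (-u)) ≤ E := fun u hu =>
    ENNReal.ofReal_le_ofReal (Real.exp_le_exp.2 (neg_le_neg hu))
  have hν3 : ν * ∑ k, p k ≤ η ^ 2 * (∑ k, p k) / 4 := by
    have := mul_le_mul_of_nonneg_right hν2 hm
    linarith
  have hν4 : ν * ∑ k, p k ≤ η ^ 2 * (∑ k, p k) / 2 := by
    have := mul_nonneg (sq_nonneg η) hm
    linarith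
  have h1 := (inputLaw_preimage (map_inputLaw_inter hp' hα' j) _).trans_le
    (vecLaw_sum_le (w := fun i => α / phat (p i) α) (M := α * ∑ k, p k) (η := δ / 4) hr
      (fun i => ⟨div_nonneg hα.le (hph i).le,
        (div_le_one (hph i)).2 (le_phat (hp i).1 hα1)⟩) (by
        rw [Finset.mul_sum]
        refine Finset.sum_le_sum fun i _ => le_of_eq ?_
        have := (hph i).ne'
        field_simp) (by linarith))
  have h2 := (inputLaw_preimage (map_inputLaw_inter hp' hα' j) _).trans_le
    (vecLaw_sum_le (w := fun _ => 1) (M := ∑ k, p k) (η := η) hr (fun i => by simp) (by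
        refine Finset.sum_le_sum fun i _ => ?_
        nlinarith [(hp i).1, hph1 i]) hη0)
  have h3 := (inputLaw_preimage (map_inputLaw_data hp' hα' j) _).trans_le
    (vecLaw_le_sum (M := ∑ k, p k) (η := η) hp' le_rfl hη0 (by linarith))
  have h4 := (inputLaw_preimage (map_inputLaw_query hp' hα' j) _).trans_le
    (vecLaw_le_sum (M := ∑ k, p k) (η := η) hp' le_rfl hη0 (by linarith))
  have h5 := (inputLaw_preimage (map_inputLaw_query hp' hα' j) _).trans_le
    (vecLaw_sum_le (w := fun _ => 1) (M := ∑ k, p k) (η := η) hp' (fun i => by simp)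
      (by simp) hη0)
  have h6 : ∀ k ∈ Finset.univ.erase j, inputLaw n p α
      {ω | ∑ i, p i * p i + η * ∑ k, p k
        ≤ ∑ i, if (ω.1 k i && ω.query j i) = true then (1 : ℝ) else 0} ≤ E := by
    intro k hk
    refine le_trans ((inputLaw_preimage
      (map_inputLaw_inter_of_ne hp' hα' (Finset.ne_of_mem_erase hk)) _).trans_le
      (vecLaw_le_sum (M := ∑ k, p k) (η := η) hr2 ?_ hη0 (by linarith))) (hexp _ hν3)
    exact Finset.sum_le_sum fun i _ => by nlinarith [hp i]
  have h1' := h1.trans (hexp _ (by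
    have := mul_le_mul_of_nonneg_right hν1 hm
    linarith))
  have h2' := h2.trans (hexp _ hν4)
  have h3' := h3.trans (hexp _ hν3)
  have h4' := h4.trans (hexp _ hν3)
  have h5' := h5.trans (hexp _ hν4)
  have h6' : inputLaw n p α (⋃ k ∈ Finset.univ.erase j,
      {ω | ∑ i, p i * p i + η * ∑ k, p k
        ≤ ∑ i, if (ω.1 k i && ω.query j i) = true then (1 : ℝ) else 0}) ≤ n * E := by
    refine (measure_biUnion_finset_le _ _).trans ((Finset.sum_le_sum h6).trans ?_)
    rw [Finset.sum_const, nsmul_eq_mul]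
    gcongr
    exact (Finset.card_le_univ _).trans (by simp)
  unfold badInputs
  refine (measure_union_le _ _).trans (le_trans (add_le_add ((measure_union_le _ _).trans
    (add_le_add ((measure_union_le _ _).trans (add_le_add ((measure_union_le _ _).trans
    (add_le_add ((measure_union_le _ _).trans (add_le_add h1' h2')) h3')) h4')) h5')) h6')
    (le_of_eq ?_))
  rw [ENNReal.ofReal_mul (by positivity), ENNReal.ofReal_add n.cast_nonneg (by norm_num),
    ENNReal.ofReal_natCast, ← hE, add_mul, add_comm]
  congr 1
  rw [ENNReal.ofReal_ofNat]
  ring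

/-- The search fails only on bad inputs or if no repetition finds a common path. -/
lemma sampleLaw_val_ne_le (h𝓗 : IsPairwiseIndepHash 𝓗) (hp : ∀ i, 0 ≤ p i ∧ p i < 1 / 2)
    (hα : 0 < α) (hα1 : α ≤ 1) (hδ : 0 < δ) (hδ1 : δ ≤ 1) (hm : 0 < ∑ k, p k)
    (hT : ∀ j < T, (j : ℝ) ≤ δ / 4 * (α * ∑ k, p k))
    (hT' : (∑ k, p k) / (1 + δ) + T / α ≤ (1 - δ / 4) * ∑ k, p k)
    (hcomp : ∀ v : List (Fin d), v.length = T → Complete n p v) (j : Fin n) :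
    sampleLaw n L T p α 𝓗 {t | (answer p α δ j t).val ≠ some j}
      ≤ inputLaw n p α (badInputs n p α δ (α / 16) j)
        + ENNReal.ofReal ((1 - 1 / (T + 1)) ^ L) := by
  have hp' : ∀ i, 0 ≤ p i ∧ p i ≤ 1 := fun i => ⟨(hp i).1, by linarith [(hp i).2]⟩
  set A : Inputs n d → Fin d → Bool := fun ω i => ω.1 j i && ω.query j i with hA
  -- outside the bad inputs, the thresholds of the critical process are admissible
  have hspec : ∀ ω, ω ∉ badInputs n p α δ (α / 16) j →
      (∑ k, p k) / (1 + δ) + T / α ≤ ∑ i, if A ω i = true then 1 / phat (p i) α else 0 := by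
    intro ω hω
    simp only [badInputs, Set.mem_union, Set.mem_ofPred_eq, not_or] at hω
    have h1 := not_le.1 hω.1.1.1.1.1
    have h2 : ∑ i, p i * phat (p i) α * (α / phat (p i) α) = α * ∑ k, p k := by
      rw [Finset.mul_sum]
      refine Finset.sum_congr rfl fun i _ => ?_
      have := (hα.trans_le (le_phat (hp i).1 hα1)).ne'
      field_simp
    have h3 : ∑ i, (if (ω.1 j i && ω.query j i) = true then α / phat (p i) α else 0)
        = α * ∑ i, if A ω i = true then 1 / phat (p i) α else 0 := by
      rw [Finset.mul_sum]
      refine Finset.sum_congr rfl fun i _ => ?_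
      simp only [hA, mul_ite, mul_one_div, mul_zero]
    rw [h2, h3] at h1
    have h4 : α * ((1 - δ / 4) * ∑ k, p k)
        < α * ∑ i, if A ω i = true then 1 / phat (p i) α else 0 := by linarith
    exact hT'.trans (lt_of_mul_lt_mul_left h4 hα.le).le
  refine sampleLaw_le h𝓗 hp' ⟨hα.le, hα1⟩
    (N := fun ω => {h | ∀ r, pathCount n p (A ω) (criticalThreshold p α (A ω))
      (List.ofFn (h r)) [] = 0}) (fun ω => ?_) (fun t ht => ?_) fun ω hω => ?_
  · have : {h : Fin L → Fin T → Hash d | ∀ r, pathCount n p (A ω) (criticalThreshold p α (A ω))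
        (List.ofFn (h r)) [] = 0} = ⋂ r, (fun h : Fin L → Fin T → Hash d =>
          (pathCount n p (A ω) (criticalThreshold p α (A ω)) (List.ofFn (h r)) [] : ENNReal)) ⁻¹'
            {0} := by
      ext h; simp
    rw [this]
    exact MeasurableSet.iInter fun r => ((measurable_pathCount T []).comp
      (measurable_pi_apply r)) (measurableSet_singleton 0)
  · by_contra hcon
    rw [not_or] at hcon
    obtain ⟨hB, hN⟩ := hcon
    obtain ⟨hcrit, hle⟩ := criticalThreshold_spec (T := T) (fun i => (hp i).1) hα hα1 hδ hδ1 hm hT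
      (hspec _ hB)
    refine ht (val_search_eq_some ?_ fun k hk => ?_)
    · have hN' : ∃ r, pathCount n p (A (t.1, t.2.1, t.2.2.1))
          (criticalThreshold p α (A (t.1, t.2.1, t.2.2.1))) (List.ofFn (t.2.2.2 r)) [] ≠ 0 := by
        by_contra h
        push Not at h
        exact hN h
      obtain ⟨r, hr⟩ := hN'
      refine ⟨r, exists_mem_explore_of_pathCount_ne_zero (x := t.1 j) (T := T) ?_ ?_ hle
        (by simp) hr⟩
      · intro i hi
        simp only [hA, Bool.and_eq_true] at hi
        exact hi.1
      · intro i hi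
        simp only [hA, Bool.and_eq_true] at hi
        exact hi.2
    · simp only [badInputs, Set.mem_union, Set.mem_ofPred_eq, not_or, Set.mem_iUnion,
        not_exists] at hB
      obtain ⟨⟨⟨⟨⟨-, h2⟩, h3⟩, h4⟩, h5⟩, h6⟩ := hB
      have h2' := not_le.1 h2
      have h3' := not_le.1 h3
      have h4' := not_le.1 h4
      have h5' := not_le.1 h5
      have h6' := not_le.1 (h6 k (Finset.mem_erase.2 ⟨hk, Finset.mem_univ k⟩))
      simp only [mul_one] at h2' h5'
      rw [← cast_weight] at h3' h4' h5'
      rw [← cast_weight (fun i => _ && _)] at h2' h6'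
      exact similarity_lt hp hα hα1 rfl hm h2' h3' h4' h5' h6'
  · obtain ⟨hcrit, -⟩ := criticalThreshold_spec (T := T) (fun i => (hp i).1) hα hα1 hδ hδ1 hm hT
      (hspec ω hω)
    exact measure_forall_pathCount_eq_zero_le h𝓗 hcrit hcomp L

end Success

/-! ### Choice of the constants -/

section Constants

/-- Every `p i > 0` is smaller than its counterpart `p i ^ (1 + ρ) / phat (p i) α` if `ρ < 0`, so
the equation that defines `ρ` has no negative solution. -/
lemma rho_nonneg {d : ℕ} {p : Fin d → ℝ} {α ρ : ℝ} (hp : ∀ i, 0 ≤ p i ∧ p i < 1 / 2)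
    (hα : 0 < α) (hα1 : α ≤ 1) (hm : 0 < ∑ i, p i)
    (h : (∑ i, p i ^ (1 + ρ) / (p i * (1 - α) + α)) = ∑ i, p i) : 0 ≤ ρ := by
  by_contra hρ
  rw [not_le] at hρ
  have hph : ∀ i, 0 < p i * (1 - α) + α ∧ p i * (1 - α) + α ≤ 1 := fun i =>
    ⟨hα.trans_le (le_phat (hp i).1 hα1), phat_le_one (by linarith [(hp i).2]) hα1⟩
  have hlt : ∀ i, 0 < p i → p i < p i ^ (1 + ρ) / (p i * (1 - α) + α) := by
    intro i hi
    have h1 : p i < p i ^ (1 + ρ) := by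
      conv_lhs => rw [← Real.rpow_one (p i)]
      exact Real.rpow_lt_rpow_of_exponent_gt hi (by linarith [(hp i).2]) (by linarith)
    rw [lt_div_iff₀ (hph i).1]
    nlinarith [(hph i).2]
  obtain ⟨i, -, hi⟩ := Finset.exists_ne_zero_of_sum_ne_zero hm.ne'
  refine absurd h (ne_of_gt (Finset.sum_lt_sum (fun k _ => ?_)
    ⟨i, Finset.mem_univ i, hlt i (lt_of_le_of_ne (hp i).1 (Ne.symm hi))⟩))
  rcases (hp k).1.eq_or_lt with h0 | h0
  · rw [← h0]
    exact div_nonneg (Real.rpow_nonneg le_rfl _) (by linarith)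
  · exact (hlt k h0).le

/-- After `levels n` coordinates every path is complete, so running out of levels loses nothing. -/
lemma complete_of_length_eq_levels {n d : ℕ} {p : Fin d → ℝ} (hn : 2 ≤ n)
    (hp : ∀ i, 0 ≤ p i ∧ p i < 1 / 2) (v : List (Fin d)) (hv : v.length = levels n) :
    Complete n p v := by
  have h1 : ∀ v : List (Fin d), (v.map p).prod ≤ (1 / 2) ^ v.length := by
    intro v
    induction v with
    | nil => simp
    | cons i v ih =>
      rw [List.map_cons, List.prod_cons, List.length_cons, pow_succ']
      exact mul_le_mul (hp i).2.le ih (prod_map_nonneg (fun i => (hp i).1) v) (by norm_num)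
  refine (h1 v).trans ?_
  rw [hv, one_div, inv_pow, ← one_div]
  have h2 : (n : ℝ) ≤ 2 ^ levels n := by
    exact_mod_cast (Nat.lt_pow_succ_log_self (by norm_num) n).le
  exact one_div_le_one_div_of_le (by positivity) h2

lemma half_lt_log {n : ℕ} (hn : 2 ≤ n) : 1 / 2 < Real.log n := by
  have h1 : Real.log 2 ≤ Real.log n := Real.log_le_log (by norm_num) (by exact_mod_cast hn)
  have := Real.log_two_gt_d9
  linarith

lemma levels_le {n : ℕ} (hn : 2 ≤ n) : (levels n : ℝ) ≤ 2 * Real.log n + 1 := by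
  have h1 : (2 : ℝ) ^ Nat.log 2 n ≤ n := by
    exact_mod_cast Nat.pow_log_le_self 2 (by omega)
  have h2 := Real.log_le_log (by positivity) h1
  rw [Real.log_pow] at h2
  have := Real.log_two_gt_d9
  have h3 : (0 : ℝ) ≤ Nat.log 2 n := Nat.cast_nonneg _
  unfold levels
  push_cast
  nlinarith

lemma reps_le {κ : ℝ} (hκ : 0 ≤ κ) {n : ℕ} (hn : 2 ≤ n) :
    (reps κ n : ℝ) ≤ (κ + 4) * Real.log n ^ 2 := by
  have h1 := Nat.ceil_lt_add_one (mul_nonneg hκ (sq_nonneg (Real.log n)))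
  have h2 := half_lt_log hn
  unfold reps
  nlinarith

/-- The growth factor `(1 + δ) ^ 2` per level costs only the power `n ^ (ε / 4)` in total. -/
lemma geom_sum_levels_le {n : ℕ} (hn : 2 ≤ n) {δ ε : ℝ} (hδ : 0 < δ) (hδ1 : δ ≤ 1)
    (hδε : δ ≤ ε / 16) :
    ∑ s ∈ Finset.range (levels n + 1), ((1 + δ) ^ 2) ^ s
      ≤ 54 * Real.log n * ((n : ℝ) ^ (ε / 8)) ^ 2 := by
  have hl := half_lt_log hn
  have hT := levels_le hn
  have hn0 : (0 : ℝ) < n := by positivity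
  set T := levels n
  have h1 : ∀ s ∈ Finset.range (T + 1), ((1 + δ) ^ 2) ^ s
      ≤ 9 * ((n : ℝ) ^ (ε / 8)) ^ 2 := by
    intro s hs
    have hsT : (s : ℝ) ≤ T := by
      exact_mod_cast Nat.lt_succ_iff.1 (Finset.mem_range.1 hs)
    have hs0 : (0 : ℝ) ≤ s := s.cast_nonneg
    calc ((1 + δ) ^ 2) ^ s ≤ (Real.exp δ ^ 2) ^ s := by
          have := Real.add_one_le_exp δ
          gcongr
          linarith
      _ = Real.exp (2 * δ * s) := by
          rw [← pow_mul, ← Real.exp_nat_mul]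
          congr 1
          push_cast
          ring
      _ ≤ Real.exp (2 + 2 * (Real.log n * (ε / 8))) := by
          refine Real.exp_le_exp.2 ?_
          have : δ * s ≤ δ * (2 * Real.log n + 1) :=
            mul_le_mul_of_nonneg_left (hsT.trans hT) hδ.le
          nlinarith
      _ = Real.exp 1 ^ 2 * ((n : ℝ) ^ (ε / 8)) ^ 2 := by
          rw [Real.rpow_def_of_pos hn0, Real.exp_add, ← Real.exp_nat_mul, ← Real.exp_nat_mul]
          norm_num
      _ ≤ 9 * ((n : ℝ) ^ (ε / 8)) ^ 2 := by
          refine mul_le_mul_of_nonneg_right ?_ (sq_nonneg _)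
          have := Real.exp_one_lt_d9
          have := Real.exp_pos 1
          nlinarith
  refine (Finset.sum_le_sum h1).trans ?_
  rw [Finset.sum_const, Finset.card_range, nsmul_eq_mul]
  push_cast
  have : (T : ℝ) + 1 ≤ 6 * Real.log n := by linarith
  have h2 : 0 ≤ 9 * ((n : ℝ) ^ (ε / 8)) ^ 2 := by positivity
  nlinarith [mul_le_mul_of_nonneg_right this h2]

lemma exp_neg_le_rpow {n : ℕ} (hn : 2 ≤ n) {x y : ℝ} (h : y * Real.log n ≤ x) :
    Real.exp (-x) ≤ (n : ℝ) ^ (-y) := by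
  rw [Real.rpow_def_of_pos (by positivity)]
  refine Real.exp_le_exp.2 ?_
  linarith

/-- The repetitions reduce the probability of failure `1 - 1 / (T + 1)` to a power of `1 / n`. -/
lemma pow_reps_le {n : ℕ} (hn : 2 ≤ n) {c κ : ℝ} (hc : 0 ≤ c + 1) (hκ : 6 * (c + 1) ≤ κ) :
    (1 - 1 / ((levels n : ℝ) + 1)) ^ reps κ n ≤ (n : ℝ) ^ (-(c + 1)) := by
  have hl := half_lt_log hn
  have hT := levels_le hn
  set T := levels n
  have hT0 : (0 : ℝ) ≤ T := T.cast_nonneg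
  have h1 : 1 - 1 / ((T : ℝ) + 1) ≤ Real.exp (-(1 / ((T : ℝ) + 1))) := by
    have := Real.add_one_le_exp (-(1 / ((T : ℝ) + 1)))
    linarith
  have h0 : 0 ≤ 1 - 1 / ((T : ℝ) + 1) := by
    rw [sub_nonneg, div_le_one (by positivity)]
    linarith
  calc _ ≤ Real.exp (-(1 / ((T : ℝ) + 1))) ^ reps κ n := pow_le_pow_left₀ h0 h1 _
    _ = Real.exp (-(reps κ n / ((T : ℝ) + 1))) := by
        rw [← Real.exp_nat_mul]
        congr 1
        ring
    _ ≤ _ := by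
        refine exp_neg_le_rpow hn ?_
        have h2 : κ * Real.log n ^ 2 ≤ reps κ n := Nat.le_ceil _
        rw [le_div_iff₀ (by positivity)]
        have h3 := mul_le_mul_of_nonneg_right hκ (sq_nonneg (Real.log n))
        have h4 : (c + 1) * Real.log n * (T + 1) ≤ (c + 1) * Real.log n * (6 * Real.log n) :=
          mul_le_mul_of_nonneg_left (by linarith) (mul_nonneg hc (by linarith))
        linarith

lemma failure_sum_le {n : ℕ} (hn : 2 ≤ n) (c : ℝ) :
    (n + 5) * (n : ℝ) ^ (-(c + 4)) + (n : ℝ) ^ (-(c + 1)) ≤ (n : ℝ) ^ (-c) := by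
  have hn0 : (0 : ℝ) < n := by positivity
  have hn2 : (2 : ℝ) ≤ n := by exact_mod_cast hn
  have h4 : (n : ℝ) ^ (-(c + 4)) = (n : ℝ) ^ (-c) / n ^ 4 := by
    rw [neg_add, ← sub_eq_add_neg, Real.rpow_sub hn0]
    norm_cast
  have h1 : (n : ℝ) ^ (-(c + 1)) = (n : ℝ) ^ (-c) / n := by
    rw [neg_add, ← sub_eq_add_neg, Real.rpow_sub hn0, Real.rpow_one]
  have h5 : (n + 5 : ℝ) / n ^ 4 + 1 / n ≤ 1 := by
    rw [div_add_div _ _ (by positivity) hn0.ne', div_le_one (by positivity)]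
    have h6 : (n : ℝ) + 5 ≤ n ^ 3 := by nlinarith [sq_nonneg ((n : ℝ) - 2)]
    have h7 : (n : ℝ) ^ 4 = n ^ 3 * n := by ring
    have h8 : (n : ℝ) ^ 4 * 2 ≤ n ^ 4 * n := mul_le_mul_of_nonneg_left hn2 (by positivity)
    have h9 := mul_le_mul_of_nonneg_right h6 hn0.le
    linarith
  rw [h4, h1]
  have h10 : 0 ≤ (n : ℝ) ^ (-c) := Real.rpow_nonneg hn0.le _
  calc _ = (n : ℝ) ^ (-c) * ((n + 5 : ℝ) / n ^ 4 + 1 / n) := by ring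
    _ ≤ (n : ℝ) ^ (-c) * 1 := mul_le_mul_of_nonneg_left h5 h10
    _ = _ := mul_one _

end Constants

/-! ### Conclusion -/

section Conclusion

variable {n d : ℕ} {p : Fin d → ℝ} {α δ κ ε γ ρ : ℝ}

/-- The constant `K` in the bounds on cost and space. -/
noncomputable def costConstant (κ ε γ : ℝ) : ℝ :=
  1080 * (κ + 4) * (1 + γ) * (8 / ε) ^ 4 + 8 * (κ + 4) * (8 / ε) ^ 3 + 2

lemma costConstant_pos (hκ : 0 ≤ κ) (hε : 0 < ε) (hγ : 0 ≤ γ) : 0 < costConstant κ ε γ := by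
  unfold costConstant
  positivity

lemma log_le_const_mul_rpow (hn : 2 ≤ n) (hε : 0 < ε) :
    Real.log n ≤ 8 / ε * (n : ℝ) ^ (ε / 8) := by
  have := Real.log_le_rpow_div (x := n) (by positivity) (show 0 < ε / 8 by linarith)
  refine this.trans (le_of_eq ?_)
  field_simp

/-- With `u = n ^ (ε / 8)`, the polylogarithmic factors cost `u ^ 4` (`log n` is at most a constant
times `u`) and the geometric sum costs another `u ^ 2`, which leaves room in `n ^ ε = u ^ 8`. -/
lemma steps_bound_le (hn : 2 ≤ n) (hd : 1 ≤ d) (hκ : 0 ≤ κ) (hε : 0 < ε) (hγ : 0 ≤ γ)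
    (hδ : 0 < δ) (hδ1 : δ ≤ 1) (hδε : δ ≤ ε / 16) :
    reps κ n * (((levels n + 1 + d * (1 + 2 * (levels n + 1)))
        + (2 * (levels n + 1) + 2 * (d + 1)) * γ) * (n : ℝ) ^ ρ
        * ∑ s ∈ Finset.range (levels n + 1), ((1 + δ) ^ 2) ^ s)
      ≤ costConstant κ ε γ * (d * (n : ℝ) ^ (ρ + ε)) := by
  have hl := half_lt_log hn
  have hT := levels_le hn
  have hL := reps_le hκ hn
  have hS := geom_sum_levels_le hn hδ hδ1 hδε
  have hlu := log_le_const_mul_rpow hn hε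
  have hn0 : (0 : ℝ) < n := by positivity
  have hu1 : 1 ≤ (n : ℝ) ^ (ε / 8) :=
    Real.one_le_rpow (by exact_mod_cast (by omega : 1 ≤ n)) (by linarith)
  have hd1 : (1 : ℝ) ≤ d := by exact_mod_cast hd
  have hpow : (n : ℝ) ^ (ρ + ε) = (n : ℝ) ^ ρ * ((n : ℝ) ^ (ε / 8)) ^ 8 := by
    rw [Real.rpow_add hn0, ← Real.rpow_natCast ((n : ℝ) ^ (ε / 8)), ← Real.rpow_mul hn0.le]
    congr 2
    push_cast
    ring
  have hT0 : (0 : ℝ) ≤ levels n := Nat.cast_nonneg _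
  have hR : 0 < (n : ℝ) ^ ρ := Real.rpow_pos_of_pos hn0 ρ
  set l := Real.log n
  set u := (n : ℝ) ^ (ε / 8)
  set T : ℝ := ((levels n : ℕ) : ℝ)
  set R := (n : ℝ) ^ ρ
  have hD : (T + 1 + d * (1 + 2 * (T + 1))) + (2 * (T + 1) + 2 * (d + 1)) * γ
      ≤ 20 * l * d * (1 + γ) := by
    have h1 : T + 1 ≤ 6 * l := by linarith
    have h2 : T + 1 ≤ d * (T + 1) := le_mul_of_one_le_left (by linarith) hd1
    have h3 : d * (3 * (T + 1) + 1) ≤ d * (20 * l) :=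
      mul_le_mul_of_nonneg_left (by linarith) (by linarith)
    have h4 : 2 * (T + 1) + 2 * (d + 1) ≤ d * (20 * l) := by
      have : d * (2 * (T + 1) + 4) ≤ d * (20 * l) :=
        mul_le_mul_of_nonneg_left (by linarith) (by linarith)
      linarith
    have h5 := mul_le_mul_of_nonneg_right h4 hγ
    linarith
  have hl4 : l ^ 4 ≤ (8 / ε * u) ^ 4 := by gcongr
  calc _ ≤ (κ + 4) * l ^ 2 * (20 * l * d * (1 + γ) * R * (54 * l * u ^ 2)) := by
        gcongr
    _ = 1080 * (κ + 4) * (1 + γ) * d * R * u ^ 2 * l ^ 4 := by ring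
    _ ≤ 1080 * (κ + 4) * (1 + γ) * d * R * u ^ 2 * (8 / ε * u) ^ 4 := by gcongr
    _ = 1080 * (κ + 4) * (1 + γ) * (8 / ε) ^ 4 * (d * (R * u ^ 6)) := by ring
    _ ≤ costConstant κ ε γ * (d * (R * u ^ 8)) := by
        have h1 : u ^ 6 ≤ u ^ 8 := pow_le_pow_right₀ hu1 (by norm_num)
        have h2 : 1080 * (κ + 4) * (1 + γ) * (8 / ε) ^ 4 ≤ costConstant κ ε γ := by
          unfold costConstant
          have : 0 ≤ 8 * (κ + 4) * (8 / ε) ^ 3 := by positivity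
          linarith
        have := (costConstant_pos hκ hε hγ).le
        gcongr
    _ = _ := by rw [hpow]

lemma space_bound_le (hn : 2 ≤ n) (hκ : 0 ≤ κ) (hε : 0 < ε) (hγ : 0 ≤ γ) (hρ : 0 ≤ ρ)
    (hδ : 0 < δ) (hδ1 : δ ≤ 1) (hδε : δ ≤ ε / 16) :
    (n * d + d + 2 * (reps κ n * levels n)) + n * (reps κ n * ((levels n + 2) * γ * (n : ℝ) ^ ρ
        * ∑ s ∈ Finset.range (levels n + 1), ((1 + δ) ^ 2) ^ s))
      ≤ costConstant κ ε γ * ((n : ℝ) ^ (1 + ρ + ε) + d * n) := by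
  have hl := half_lt_log hn
  have hT := levels_le hn
  have hL := reps_le hκ hn
  have hS := geom_sum_levels_le hn hδ hδ1 hδε
  have hlu := log_le_const_mul_rpow hn hε
  have hn0 : (0 : ℝ) < n := by positivity
  have hn1 : (1 : ℝ) ≤ n := by exact_mod_cast (by omega : 1 ≤ n)
  have hu1 : 1 ≤ (n : ℝ) ^ (ε / 8) := Real.one_le_rpow hn1 (by linarith)
  have hpow : (n : ℝ) ^ (1 + ρ + ε) = n * (n : ℝ) ^ ρ * ((n : ℝ) ^ (ε / 8)) ^ 8 := by
    rw [Real.rpow_add hn0, Real.rpow_add hn0, Real.rpow_one,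
      ← Real.rpow_natCast ((n : ℝ) ^ (ε / 8)), ← Real.rpow_mul hn0.le]
    congr 2
    push_cast
    ring
  have hT0 : (0 : ℝ) ≤ levels n := Nat.cast_nonneg _
  have hR : 1 ≤ (n : ℝ) ^ ρ := Real.one_le_rpow hn1 hρ
  set l := Real.log n
  set u := (n : ℝ) ^ (ε / 8)
  set T : ℝ := ((levels n : ℕ) : ℝ)
  set R := (n : ℝ) ^ ρ
  have hd0 : (0 : ℝ) ≤ d := d.cast_nonneg
  have hl3 : l ^ 3 ≤ (8 / ε * u) ^ 3 := by gcongr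
  have hl4 : l ^ 4 ≤ (8 / ε * u) ^ 4 := by gcongr
  have h1 : 2 * (reps κ n * T) ≤ 8 * (κ + 4) * (8 / ε) ^ 3 * (n * R * u ^ 8) := by
    calc 2 * (reps κ n * T) ≤ 2 * ((κ + 4) * l ^ 2 * (4 * l)) := by
          gcongr
          linarith
      _ = 8 * (κ + 4) * l ^ 3 := by ring
      _ ≤ 8 * (κ + 4) * (8 / ε * u) ^ 3 := by gcongr
      _ = 8 * (κ + 4) * (8 / ε) ^ 3 * u ^ 3 := by ring
      _ ≤ 8 * (κ + 4) * (8 / ε) ^ 3 * (n * R * u ^ 8) := by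
          have h2 : u ^ 3 ≤ u ^ 8 := pow_le_pow_right₀ hu1 (by norm_num)
          have h3 : 1 ≤ n * R := one_le_mul_of_one_le_of_one_le hn1 hR
          have h4 : u ^ 8 ≤ n * R * u ^ 8 := le_mul_of_one_le_left (by positivity) h3
          gcongr
          exact h2.trans h4
  have h2 : n * (reps κ n * ((T + 2) * γ * R
        * ∑ s ∈ Finset.range (levels n + 1), ((1 + δ) ^ 2) ^ s))
      ≤ 1080 * (κ + 4) * (1 + γ) * (8 / ε) ^ 4 * (n * R * u ^ 8) := by
    calc _ ≤ n * ((κ + 4) * l ^ 2 * ((8 * l) * γ * R * (54 * l * u ^ 2))) := by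
          gcongr
          linarith
      _ = 432 * (κ + 4) * γ * n * R * u ^ 2 * l ^ 4 := by ring
      _ ≤ 432 * (κ + 4) * γ * n * R * u ^ 2 * (8 / ε * u) ^ 4 := by gcongr
      _ = 432 * (κ + 4) * γ * (8 / ε) ^ 4 * (n * R * u ^ 6) := by ring
      _ ≤ _ := by
          have h1 : u ^ 6 ≤ u ^ 8 := pow_le_pow_right₀ hu1 (by norm_num)
          gcongr
          · norm_num
          · linarith
  have h3 : (n : ℝ) * d + d ≤ 2 * (d * n) := by
    have := le_mul_of_one_le_right hd0 hn1
    linarith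
  have h4 : 0 ≤ n * R * u ^ 8 := by positivity
  have h5 : 0 ≤ (d : ℝ) * n := by positivity
  rw [hpow]
  unfold costConstant
  have h6 : 0 ≤ 1080 * (κ + 4) * (1 + γ) * (8 / ε) ^ 4 + 8 * (κ + 4) * (8 / ε) ^ 3 := by
    positivity
  have h7 := mul_nonneg h6 h5
  linarith

end Conclusion

end SkewSearch

theorem theorem1 (α : ℝ) (hα : 0 < α) (hα1 : α ≤ 1) (ε : ℝ) (hε : 0 < ε) (c : ℝ) (hc : 0 < c) :
    ∃ C > (0 : ℝ), ∃ δ > (0 : ℝ), ∃ κ > (0 : ℝ), ∃ K > (0 : ℝ),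
      ∀ (n d : ℕ) (p : Fin d → ℝ), 2 ≤ n → (∀ i, 0 ≤ p i ∧ p i < 1 / 2) →
      C * Real.log n ≤ ∑ i, p i →
      ∀ ρ : ℝ, (∑ i, p i ^ (1 + ρ) / (p i * (1 - α) + α)) = ∑ i, p i →
      ∀ 𝓗 : MeasureTheory.Measure (SkewSearch.Hash d), SkewSearch.IsPairwiseIndepHash 𝓗 →
        (∀ j : Fin n,
          SkewSearch.sampleLaw n (SkewSearch.reps κ n) (SkewSearch.levels n) p α 𝓗
              {t | (SkewSearch.answer p α δ j t).val ≠ some j}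
            ≤ ENNReal.ofReal ((n : ℝ) ^ (-c)) ∧
          ∫⁻ t, ((SkewSearch.answer p α δ j t).steps : ENNReal)
              ∂(SkewSearch.sampleLaw n (SkewSearch.reps κ n) (SkewSearch.levels n) p α 𝓗)
            ≤ ENNReal.ofReal (K * (d * (n : ℝ) ^ (ρ + ε)))) ∧
        ∫⁻ t, ((SkewSearch.built p α δ t).space : ENNReal)
            ∂(SkewSearch.sampleLaw n (SkewSearch.reps κ n) (SkewSearch.levels n) p α 𝓗)
          ≤ ENNReal.ofReal (K * ((n : ℝ) ^ (1 + ρ + ε) + d * n)) := by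
  open SkewSearch in
  -- the choice of `δ` keeps `(1 + δ) ^ (2 T)` below a small power of `n`
  obtain ⟨δ, hδ, hδ1, hδε⟩ : ∃ δ : ℝ, 0 < δ ∧ δ ≤ 1 ∧ δ ≤ ε / 16 :=
    ⟨min 1 (ε / 16), lt_min one_pos (by linarith), min_le_left _ _, min_le_right _ _⟩
  -- `ν` is the rate of all the Chernoff bounds
  obtain ⟨ν, hν, hν1, hν2⟩ : ∃ ν : ℝ, 0 < ν ∧ ν ≤ δ ^ 2 * α / 32 ∧ ν ≤ (α / 16) ^ 2 / 4 :=
    ⟨min (δ ^ 2 * α / 32) ((α / 16) ^ 2 / 4), lt_min (by positivity) (by positivity),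
      min_le_left _ _, min_le_right _ _⟩
  have hγ : 0 ≤ 4 / α := by positivity
  have hκ : 0 ≤ 6 * (c + 1) := by linarith
  refine ⟨(c + 4) / ν + 16 / (α * δ), by positivity, δ, hδ, 6 * (c + 1), by linarith,
    costConstant (6 * (c + 1)) ε (4 / α), costConstant_pos hκ hε hγ, ?_⟩
  intro n d p hn hp hm ρ hρeq 𝓗 h𝓗
  have hl := half_lt_log hn
  have hTle := levels_le hn
  have hp' : ∀ i, 0 ≤ p i ∧ p i ≤ 1 := fun i => ⟨(hp i).1, by linarith [(hp i).2]⟩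
  have hm1 : (c + 4) * Real.log n ≤ ν * ∑ i, p i := by
    have h1 : (c + 4) / ν * Real.log n ≤ ∑ i, p i := by
      have : 0 ≤ 16 / (α * δ) * Real.log n := by positivity
      linarith
    have h2 := mul_le_mul_of_nonneg_left h1 hν.le
    have h3 : ν * ((c + 4) / ν * Real.log n) = (c + 4) * Real.log n := by field_simp
    linarith
  have hm2 : 16 * Real.log n ≤ δ * (α * ∑ i, p i) := by
    have h1 : 16 / (α * δ) * Real.log n ≤ ∑ i, p i := by
      have : 0 ≤ (c + 4) / ν * Real.log n := by positivity
      linarith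
    have h2 := mul_le_mul_of_nonneg_left h1 (mul_pos hα hδ).le
    have h3 : α * δ * (16 / (α * δ) * Real.log n) = 16 * Real.log n := by field_simp
    linarith
  have hm0 : 0 < ∑ i, p i := by
    have h1 : 0 < ν * ∑ i, p i := lt_of_lt_of_le (by positivity) hm1
    exact pos_of_mul_pos_right h1 hν.le
  have hd : 1 ≤ d := by
    rcases Nat.eq_zero_or_pos d with rfl | h
    · simp at hm0
    · exact h
  have hρ := rho_nonneg hp hα hα1 hm0 hρeq
  have hj : ∀ j < levels n, (j : ℝ) ≤ δ / 4 * (α * ∑ k, p k) := by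
    intro j hj
    have : (j : ℝ) + 1 ≤ levels n := by exact_mod_cast hj
    linarith
  have hbounds := fun j (h : j < levels n) i =>
    threshold_bounds (fun i => (hp i).1) hα hα1 hδ hδ1 hm0 (hj j h) i
  have hph : ∀ i, 0 < phat (p i) α := fun i => hα.trans_le (le_phat (hp i).1 hα1)
  have ht : ∀ j < levels n, ∀ i, 0 ≤ threshold p α δ j i := fun j h i =>
    le_trans (div_nonneg (by linarith) (mul_pos (hph i) hm0).le) (hbounds j h i).1
  have hsum : ∀ j < levels n, ∑ i, p i ^ (1 + ρ) * threshold p α δ j i ≤ (1 + δ) ^ 2 := by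
    intro j h
    calc _ ≤ ∑ i, (1 + δ) ^ 2 / (∑ k, p k) * (p i ^ (1 + ρ) / (p i * (1 - α) + α)) := by
          refine Finset.sum_le_sum fun i _ => ?_
          refine (mul_le_mul_of_nonneg_left (hbounds j h i).2
            (Real.rpow_nonneg (hp i).1 _)).trans (le_of_eq ?_)
          have h1 := (hph i).ne'
          have h2 := hm0.ne'
          change _ = (1 + δ) ^ 2 / (∑ k, p k) * (p i ^ (1 + ρ) / phat (p i) α)
          field_simp
      _ = _ := by
          rw [← Finset.mul_sum, hρeq]
          field_simp
  have hmass : ∀ j < levels n, ∑ i, p i * threshold p α δ j i ≤ 4 / α := by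
    intro j h
    calc _ ≤ ∑ i, 4 / (α * ∑ k, p k) * p i := by
          refine Finset.sum_le_sum fun i _ => ?_
          rw [mul_comm]
          refine mul_le_mul_of_nonneg_right ((hbounds j h i).2.trans ?_) (hp i).1
          have := le_phat (hp i).1 hα1
          gcongr
          nlinarith
      _ = _ := by
          rw [← Finset.mul_sum]
          field_simp
  refine ⟨fun j => ⟨?_, ?_⟩, ?_⟩
  · have hT' : (∑ k, p k) / (1 + δ) + levels n / α ≤ (1 - δ / 4) * ∑ k, p k := by
      have h1 : (∑ k, p k) / (1 + δ) ≤ (1 - δ / 2) * ∑ k, p k := by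
        rw [div_le_iff₀ (by linarith)]
        have : 0 ≤ δ / 2 * (1 - δ) * ∑ k, p k :=
          mul_nonneg (mul_nonneg (by linarith) (by linarith)) hm0.le
        linarith
      have h2 : (levels n : ℝ) / α ≤ δ / 4 * ∑ k, p k := by
        rw [div_le_iff₀ hα]
        linarith
      linarith
    refine (sampleLaw_val_ne_le h𝓗 hp hα hα1 hδ hδ1 hm0 hj hT'
      (complete_of_length_eq_levels hn hp) j).trans ?_
    have hbad := inputLaw_badInputs_le (n := n) hp hα hα1 hδ (show 0 ≤ α / 16 by linarith)
      (by linarith) hν1 hν2 j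
    have hrep := pow_reps_le hn (show 0 ≤ c + 1 by linarith) le_rfl
    refine (add_le_add hbad (ENNReal.ofReal_le_ofReal hrep)).trans ?_
    rw [← ENNReal.ofReal_add (by positivity) (by positivity)]
    refine ENNReal.ofReal_le_ofReal (le_trans ?_ (failure_sum_le hn c))
    have := exp_neg_le_rpow hn hm1
    gcongr
  · exact (lintegral_steps_le hn hp' ⟨hα.le, hα1⟩ h𝓗 hρ (sq_nonneg (1 + δ)) hγ ht hsum hmass
      j).trans (ENNReal.ofReal_le_ofReal (steps_bound_le hn hd hκ hε hγ hδ hδ1 hδε))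
  · exact (lintegral_space_le hn hp' ⟨hα.le, hα1⟩ h𝓗 hρ (sq_nonneg (1 + δ)) hγ ht hsum
      hmass).trans (ENNReal.ofReal_le_ofReal (space_bound_le hn hκ hε hγ hρ hδ hδ1 hδε))
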